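/- **Setting.** Let $\mathcal T=(a,b)\subset\mathbb R$ be a bounded open interval and $\mathcal X$ a compact space with its Borel $\sigma$-algebra. Let $k:\mathcal X\times\mathcal X\to\mathbb R$ be a measurable reproducing kernel with Hilbert space $\mathcal H$ that is bounded, i.e. $k(x,x)<C$ for some $C$ and all $x$. For a finite signed measure $\sigma$ on $\mathcal X$ let $\mu_\sigma\in\mathcal H$ be its kernel embedding, $\langle\mu_\sigma,f\rangle=\int f\,d\sigma$ for $f\in\mathcal H$, and $\|\sigma\|_k=\|\mu_\sigma\|_{\mathcal H}$. Let $(p_t)_{t\in\mathcal T}$ be a drift process, i.e. a Markov kernel from $\mathcal T$ to $\mathcal X$. It is called classically (weakly, distributionally) differentiable if $t\mapsto p_t(A)$ is so on $\mathcal T$ for every measurable $A$. Let $K_{t,s}=\langle\mu_{p_t},\mu_{p_s}\rangle$. An eigenfunction with eigenvalue $\lambda$ is a non-zero $f\in L^2(\mathcal T)$ with $\int_{\mathcal T}K_{t,s}f(s)\,ds=\lambda f(t)$ for all $t\in\mathcal T$. A weight is an integrable $w:\mathbb R\to\mathbb R$ of bounded support with an antiderivative $W$ of bounded support ($\int_x^y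 w=W(y)-W(x)$). Let $w*p_t=\int_{\mathcal T}w(t-s)\,p_s\,ds$, a signed measure, and let $\mathcal T_W=\{t\in\mathbb R: t-\operatorname{supp}W\subset\mathcal T\}$ be the set of times whose whole window lies in $\mathcal T$. **Theorem.** 1. If $p$ is classically (resp. weakly, distributionally) differentiable, then every eigenfunction of $K$ with non-zero eigenvalue is classically (resp. weakly, distributionally) differentiable on $\mathcal T$. There is a countable complete orthonormal system $(f_i)$ of eigenfunctions with non-zero eigenvalues $\lambda_i$ (the integral operator vanishes on the orthogonal complement of the $f_i$). In every such system all $\lambda_i>0$. 2. For every such system and every weight, $$\sum_i\lambda_i\,(W*f_i')^2(t)=\|w*p_t\|_k^2\qquad\text{in }L^2(\mathcal T_W).$$ Here, if $f_i'$ denotes the distributional derivative, $W*f_i'$ is on $\mathcal T_W$ a regular distribution, given by a function. If all $f_i$ have weak derivatives, or are classically differentiable with locally integrable derivatives, the identity also holds with $(W*f_i')(t)=\int_{\mathcal T}W(t-s)f_i'(s)\,ds$. 3. Suppose $p$ has abrupt drift only: there are change points $t_1<\dots<t_n$ in $\mathcal T$ and probability measures $P_0,\dots,P_n$ with $P_{j-1}\ne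 P_j$ such that, for almost every $t$, $p_t=P_0$ for $t<t_1$, $p_t=P_j$ on $[t_j,t_{j+1})$, and $p_t=P_n$ for $t\ge t_n$. Then for every system as above there are numbers $s_{ij}$, not depending on $w$ and $W$, with $\sqrt{\lambda_i}\,f_i'=\sum_j s_{ij}\delta_{t_j}$ as distributions and $\sum_i s_{ij}^2=\|P_j-P_{j-1}\|_k^2$ for each $j$, such that for every weight $$\sum_i\Big(\sum_{j=1}^n s_{ij}W(t-t_j)\Big)^2=\|w*p_t\|_k^2,$$ in $L^2(\mathcal T_W)$ and also for every $t\in\mathcal T_W$. 4. If moreover $\{W\ne0\}\subset[c,c+l]$ with $l$ smaller than every gap $t_{j+1}-t_j$, then for all $t\in\mathcal T_W$ $$\sum_{j=1}^n\|P_j-P_{j-1}\|_k\,|W(t-t_j)|=\|w*p_t\|_k ,$$ and the absolute value can be dropped when $W\ge0$. -/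

import Mathlib

open MeasureTheory ProbabilityTheory Set Filter Topology TopologicalSpace
open scoped Distributions ContDiff

namespace Drift

noncomputable section

section KernelEmbedding

variable {X : Type*} (H : Type*) [NormedAddCommGroup H] [InnerProductSpace ℝ H]
  [CompleteSpace H] [RKHS ℝ H X ℝ]

/-- The reproducing kernel `k(x, y)` of the Hilbert space `H` of real functions on `X`, as a
real number. -/
def scalarKernel (x y : X) : ℝ := RKHS.kernel H x y 1

variable {H} in
theorem kerFun_one_apply (x y : X) : (RKHS.kerFun H y 1 : H) x = scalarKernel H x y :=
  RKHS.kerFun_apply H y 1 x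

variable {H} in
theorem norm_apply_le_of_bounded {C : ℝ} (hC : ∀ x, scalarKernel H x x < C) (f : H) (x : X) :
    |f x| ≤ √C * ‖f‖ := by
  have h1 : f x = inner ℝ (RKHS.kerFun H x 1 : H) f := by
    rw [RKHS.kerFun_inner]; simp
  have h2 : ‖(RKHS.kerFun H x 1 : H)‖ ≤ √C := by
    apply Real.le_sqrt_of_sq_le
    rw [← real_inner_self_eq_norm_sq, RKHS.kerFun_inner, kerFun_one_apply]
    simpa using (hC x).le
  rw [h1]
  exact (abs_real_inner_le_norm _ _).trans (by gcongr)

variable [MeasurableSpace X]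

/-- The integral of a real function against a finite signed measure `σ = σ⁺ - σ⁻`. -/
def signedIntegral (σ : SignedMeasure X) (f : X → ℝ) : ℝ :=
  ∫ x, f x ∂σ.toJordanDecomposition.posPart - ∫ x, f x ∂σ.toJordanDecomposition.negPart

open Classical in
/-- The kernel embedding `μ_σ = ∫ k(x, ·) dσ(x) ∈ H` of a finite signed measure, as a weak
integral: it is the element of `H` with `⟪μ_σ, f⟫ = ∫ f dσ` for all `f ∈ H`. It is unique, and
for a bounded measurable kernel it exists (`inner_kernelMean`). -/
def kernelMean (σ : SignedMeasure X) : H :=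
  if h : ∃ m : H, ∀ f : H, inner ℝ m f = signedIntegral σ (fun x => f x) then h.choose else 0

/-- `‖σ‖_k`, the norm in `H` of the kernel embedding of `σ`. -/
def kernelNorm (σ : SignedMeasure X) : ℝ := ‖kernelMean H σ‖

variable {H}

theorem measurable_apply (hk : Measurable (Function.uncurry (scalarKernel (X := X) H))) (f : H) :
    Measurable (fun x => f x) := by
  let S : Submodule ℝ H :=
    { carrier := {g | Measurable (fun x => g x)}
      add_mem' := fun {g h} hg hh => by
        have hgh : Measurable (fun x => g x + h x) := Measurable.add hg hh
        simpa using hgh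
      zero_mem' := by
        simp
      smul_mem' := fun c g hg => by
        have hcg : Measurable (fun x => c * g x) := Measurable.const_mul hg c
        simpa using hcg }
  have hS : IsClosed (S : Set H) := by
    rw [← isSeqClosed_iff_isClosed]
    intro u g hu hg
    refine measurable_of_tendsto_metrizable (f := fun n x => u n x) (fun n => hu n) ?_
    rw [tendsto_pi_nhds]
    intro x
    exact ((RKHS.continuous_eval (H := H) x).tendsto g).comp hg
  have hle : Submodule.span ℝ {RKHS.kerFun H x v | (x : X) (v : ℝ)} ≤ S := by
    rw [Submodule.span_le]
    rintro _ ⟨y, v, rfl⟩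
    have h1 : RKHS.kerFun H y v = v • (RKHS.kerFun H y 1 : H) := by
      rw [← map_smul]; simp
    rw [h1]
    refine S.smul_mem v ?_
    change Measurable (fun x => (RKHS.kerFun H y 1 : H) x)
    simp only [kerFun_one_apply]
    exact Measurable.of_uncurry_right (f := scalarKernel (X := X) H) hk
  have hf : f ∈ (Submodule.span ℝ {RKHS.kerFun H x v | (x : X) (v : ℝ)}).topologicalClosure := by
    have hd := RKHS.kerFun_dense (X := X) (V := ℝ) (𝕜 := ℝ) H
    rw [hd]
    exact Submodule.mem_top
  exact Submodule.topologicalClosure_minimal _ hle hS hf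

theorem integrable_apply (hk : Measurable (Function.uncurry (scalarKernel (X := X) H)))
    (hb : ∃ C, ∀ x : X, scalarKernel H x x < C) (f : H) (μ : Measure X) [IsFiniteMeasure μ] :
    Integrable (fun x => f x) μ := by
  obtain ⟨C, hC⟩ := hb
  exact Integrable.of_bound (measurable_apply hk f).aestronglyMeasurable (√C * ‖f‖)
    (Eventually.of_forall fun x => norm_apply_le_of_bounded hC f x)

/-- For a bounded measurable kernel the kernel embedding has its defining property. -/
theorem inner_kernelMean (hk : Measurable (Function.uncurry (scalarKernel (X := X) H)))
    (hb : ∃ C, ∀ x : X, scalarKernel H x x < C) (σ : SignedMeasure X) (f : H) :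
    inner ℝ (kernelMean H σ) f = signedIntegral σ (fun x => f x) := by
  have hi := fun (g : H) (μ : Measure X) [IsFiniteMeasure μ] => integrable_apply hk hb g μ
  obtain ⟨C, hC⟩ := hb
  let L : H →ₗ[ℝ] ℝ :=
    { toFun := fun g => signedIntegral σ (fun x => g x)
      map_add' := fun g h => by
        simp only [signedIntegral, RKHS.coe_add, Pi.add_apply]
        rw [integral_add (hi g _) (hi h _), integral_add (hi g _) (hi h _)]
        ring
      map_smul' := fun c g => by
        simp only [signedIntegral, RKHS.coe_smul, Pi.smul_apply, smul_eq_mul, integral_const_mul,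
          RingHom.id_apply]
        ring }
  have hL : ∀ g, ‖L g‖ ≤ (√C * (σ.toJordanDecomposition.posPart.real univ +
      σ.toJordanDecomposition.negPart.real univ)) * ‖g‖ := by
    intro g
    have hb := fun (μ : Measure X) [IsFiniteMeasure μ] =>
      norm_integral_le_of_norm_le_const (μ := μ) (f := fun x => g x) (C := √C * ‖g‖)
        (Eventually.of_forall fun x => norm_apply_le_of_bounded hC g x)
    have h1 : ‖L g‖ ≤ _ := norm_sub_le
      (∫ x, g x ∂σ.toJordanDecomposition.posPart) (∫ x, g x ∂σ.toJordanDecomposition.negPart)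
    have h2 := hb σ.toJordanDecomposition.posPart
    have h3 := hb σ.toJordanDecomposition.negPart
    linarith
  have hex : ∃ m : H, ∀ g : H, inner ℝ m g = signedIntegral σ (fun x => g x) :=
    ⟨(InnerProductSpace.toDual ℝ H).symm (L.mkContinuous _ hL), fun g => by
      rw [InnerProductSpace.toDual_symm_apply]; rfl⟩
  rw [kernelMean, dif_pos hex]
  exact hex.choose_spec f

end KernelEmbedding

section Dynamics

/- A drift process over the open time interval `(a, b)` is given by a Markov kernel
`p : Kernel ℝ X`; everything below uses only its values at the times in `(a, b)`, and every Markov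
kernel from `(a, b)` to `X` is the restriction of such a kernel. -/

variable {X : Type*} [MeasurableSpace X]

/-- The kernel auto-correlation `K_{t,s} = ⟪μ_{p_t}, μ_{p_s}⟫`. -/
def autoCorr (H : Type*) [NormedAddCommGroup H] [InnerProductSpace ℝ H] [CompleteSpace H]
    [RKHS ℝ H X ℝ] (p : Kernel ℝ X) [IsMarkovKernel p] (t s : ℝ) : ℝ :=
  inner ℝ (kernelMean H (p t).toSignedMeasure) (kernelMean H (p s).toSignedMeasure)

/-- The signed measure `∫ p_s dη(s)` on `X`, for a finite signed measure `η` on the times. -/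
def mixture (p : Kernel ℝ X) [IsMarkovKernel p] (η : SignedMeasure ℝ) : SignedMeasure X :=
  (η.toJordanDecomposition.posPart.bind p).toSignedMeasure
    - (η.toJordanDecomposition.negPart.bind p).toSignedMeasure

/-- The convolution `(w * p)_t = ∫_{(a,b)} w(t - s) p_s ds`, a finite signed measure on `X`. -/
def convDrift (p : Kernel ℝ X) [IsMarkovKernel p] (a b : ℝ) (w : ℝ → ℝ) (t : ℝ) :
    SignedMeasure X :=
  mixture p ((volume.restrict (Ioo a b)).withDensityᵥ (fun s => w (t - s)))

/-- `w` is an integrable weighting function of bounded support and `W` is an antiderivative of `w`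
of bounded support. -/
structure IsWeight (w W : ℝ → ℝ) : Prop where
  integrable : Integrable w
  bounded_support : Bornology.IsBounded (Function.support w)
  bounded_support_antideriv : Bornology.IsBounded (Function.support W)
  antideriv : ∀ x y : ℝ, ∫ s in x..y, w s = W y - W x

/-- The times `t` at which the whole window `t - supp W` lies in the time interval `(a, b)`. -/
def windowTimes (a b : ℝ) (W : ℝ → ℝ) : Set ℝ := {t | ∀ u ∈ tsupport W, t - u ∈ Ioo a b}

/-- The open interval `(a, b)` as an open set. -/
def timeDomain (a b : ℝ) : Opens ℝ := ⟨Ioo a b, isOpen_Ioo⟩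

/-- The distribution `D` on `(a, b)` is the distributional derivative of the locally integrable
function `f`. -/
def IsDistribDeriv (a b : ℝ) (f : ℝ → ℝ) (D : 𝓓'(timeDomain a b, ℝ)) : Prop :=
  LocallyIntegrableOn f (Ioo a b) ∧
    ∀ φ : 𝓓(timeDomain a b, ℝ), D φ = -∫ t, f t * deriv φ t

/-- The locally integrable function `g` is the weak derivative on `(a, b)` of the locally
integrable function `f`. -/
def IsWeakDeriv (a b : ℝ) (f g : ℝ → ℝ) : Prop :=
  LocallyIntegrableOn f (Ioo a b) ∧ LocallyIntegrableOn g (Ioo a b) ∧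
    ∀ φ : 𝓓(timeDomain a b, ℝ), ∫ t, g t * φ t = -∫ t, f t * deriv φ t

/-- On the set `windowTimes a b W` the convolution `W * D` of the function `W` with the
distribution `D` on `(a, b)` is the regular distribution given by the function `u`: tested against
`φ` it is `D ψ` for the test function `ψ(s) = ∫ W(t - s) φ(t) dt` on `(a, b)`. -/
def IsConvolution (a b : ℝ) (W : ℝ → ℝ) (D : 𝓓'(timeDomain a b, ℝ)) (u : ℝ → ℝ) : Prop :=
  LocallyIntegrableOn u (windowTimes a b W) ∧
    ∀ φ : ℝ → ℝ, ContDiff ℝ ∞ φ → HasCompactSupport φ → tsupport φ ⊆ windowTimes a b W →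
      ∃ ψ : 𝓓(timeDomain a b, ℝ), (∀ s, ψ s = ∫ t, W (t - s) * φ t) ∧ ∫ t, u t * φ t = D ψ

/-- Classical differentiability of a drift process. -/
def ClassicallyDifferentiable (p : Kernel ℝ X) (a b : ℝ) : Prop :=
  ∀ A : Set X, MeasurableSet A → DifferentiableOn ℝ (fun t => (p t).real A) (Ioo a b)

/-- Weak differentiability of a drift process. -/
def WeaklyDifferentiable (p : Kernel ℝ X) (a b : ℝ) : Prop :=
  ∀ A : Set X, MeasurableSet A → ∃ g : ℝ → ℝ, IsWeakDeriv a b (fun t => (p t).real A) g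

/-- Distributional differentiability of a drift process. -/
def DistribDifferentiable (p : Kernel ℝ X) (a b : ℝ) : Prop :=
  ∀ A : Set X, MeasurableSet A →
    ∃ D : 𝓓'(timeDomain a b, ℝ), IsDistribDeriv a b (fun t => (p t).real A) D

/-- `f` is an eigenfunction in `L²(a, b)`, with eigenvalue `lam`, of the integral operator with
kernel `K`; the eigenvalue equation holds at every point of `(a, b)`. -/
structure IsEigenfunction (K : ℝ → ℝ → ℝ) (a b lam : ℝ) (f : ℝ → ℝ) : Prop where
  memLp : MemLp f 2 (volume.restrict (Ioo a b))
  ne_zero : ¬ f =ᵐ[volume.restrict (Ioo a b)] 0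
  eigen : ∀ t ∈ Ioo a b, ∫ s in Ioo a b, K t s * f s = lam * f t

/-- A complete orthonormal system of eigenfunctions with non-zero eigenvalues of the integral
operator with kernel `K`, repeated by multiplicity: the operator vanishes on the orthogonal
complement. -/
structure IsEigensystem (K : ℝ → ℝ → ℝ) (a b : ℝ) {ι : Type} (lam : ι → ℝ) (f : ι → ℝ → ℝ) :
    Prop where
  eigenfunction : ∀ i, IsEigenfunction K a b (lam i) (f i)
  eigenvalue_ne_zero : ∀ i, lam i ≠ 0
  normalized : ∀ i, ∫ t in Ioo a b, f i t ^ 2 = 1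
  orthogonal : ∀ i j, i ≠ j → ∫ t in Ioo a b, f i t * f j t = 0
  complete : ∀ g : ℝ → ℝ, MemLp g 2 (volume.restrict (Ioo a b)) →
    (∀ i, ∫ t in Ioo a b, f i t * g t = 0) →
      ∀ᵐ t ∂volume.restrict (Ioo a b), ∫ s in Ioo a b, K t s * g s = 0

/-- The process has abrupt drift only, with change points `τ 0 < ⋯ < τ (n - 1)` in `(a, b)` and
concepts `P 0, …, P n`: for almost all `t` it is `P j` for the `j` such that exactly the first `j`
change points are `≤ t`. -/
structure IsAbrupt (p : Kernel ℝ X) (a b : ℝ) {n : ℕ} (τ : Fin n → ℝ)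
    (P : Fin (n + 1) → ProbabilityMeasure X) : Prop where
  strictMono : StrictMono τ
  mem : ∀ j, τ j ∈ Ioo a b
  ne : ∀ j : Fin n, P j.castSucc ≠ P j.succ
  eq : ∀ᵐ t ∂volume.restrict (Ioo a b), ∀ j : Fin (n + 1),
    (∀ i : Fin n, τ i ≤ t ↔ i.castSucc < j) → p t = (P j : Measure X)

/-- The jump height `‖P_j - P_{j-1}‖_k` at the change point `j`. -/
def jump (H : Type*) [NormedAddCommGroup H] [InnerProductSpace ℝ H] [CompleteSpace H]
    [RKHS ℝ H X ℝ] {n : ℕ} (P : Fin (n + 1) → ProbabilityMeasure X) (j : Fin n) : ℝ :=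
  kernelNorm H ((P j.succ : Measure X).toSignedMeasure
    - (P j.castSucc : Measure X).toSignedMeasure)

/-- `∑ i, F i = G` with convergence in `L²(S)`. -/
def HasSumL2 {ι : Type*} (S : Set ℝ) (F : ι → ℝ → ℝ) (G : ℝ → ℝ) : Prop :=
  (∀ i, MemLp (F i) 2 (volume.restrict S)) ∧ MemLp G 2 (volume.restrict S) ∧
    Tendsto (fun J : Finset ι => eLpNorm (fun t => ∑ i ∈ J, F i t - G t) 2 (volume.restrict S))
      atTop (𝓝 0)

end Dynamics

end

end Drift

open Drift

namespace Drift

noncomputable section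

/-! ### Integration against signed measures and mixtures -/

section SignedIntegral

variable {X : Type*} [MeasurableSpace X]

/-! The kernel `K` is a Gram kernel, so its integral operator factors through `H`. Write `μ_t` for
the embedding of `p_t` and let `S : H → L²` send `h` to `t ↦ ⟪μ_t, h⟫`; then `S* g = ∫ g(s) μ_s ds`
(`driftMean`) and the operator is `S S*`. It is symmetric and compact, so the spectral theorem gives
a complete system, with eigenvalues `λ_i = ‖S* f_i‖² > 0`. The vectors `e_i = λ_i^(-1/2) S* f_i` are
orthonormal in `H`, and anything orthogonal to all of them is orthogonal to every mixture `∫ g(s)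
μ_s ds` with `g` integrable (`inner_driftMean_eq_zero`). Parseval's identity therefore reads `‖∫ g
μ_s ds‖² = ∑ λ_i (∫ g f_i)²`.

For `g = w(t - ·)` the left side is `‖w * p_t‖_k²`, and integration by parts turns `w * f_i` into `W
* f_i'`. This is the main identity, pointwise in `t`; dominated convergence upgrades it to `L²`.

An eigenfunction is `f(t) = λ⁻¹ ∫ h dp_t` with `h = S* f` bounded and measurable. By the layer cake
formula this is an integral over levels `u` of `p_t(h + B ≥ u)`, up to constants, and the task is to
differentiate under that integral. The required bound, uniform in `u`, is a version of Nikodym's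
boundedness theorem for chains of sets (`exists_abs_superlevel_le`), proved by Baire category on
`{0,1}^ℕ`. Classical derivatives use it on difference quotients, weak derivatives on mollified ones.
A distributional derivative exists for any locally integrable function.

For abrupt drift, `μ_t` is almost everywhere a step function with jumps `m_j`, so `w * p_t` embeds
as `∑ W(t - t_j) m_j` (`driftMean_weight`), and `s_ij = ⟪m_j, e_i⟫` are its coordinates. Each `m_j`
is itself a mixture, so Parseval also gives the jump heights. A window shorter than all gaps sees at
most one jump, and the norm of the sum is then a single term. -/

theorem integrable_of_abs_le {μ : Measure X} [IsFiniteMeasure μ] {f : X → ℝ} {C : ℝ}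
    (hf : Measurable f) (hC : ∀ x, |f x| ≤ C) : Integrable f μ :=
  Integrable.of_bound hf.aestronglyMeasurable C (Eventually.of_forall hC)

/-- The equality `σ⁺ - σ⁻ = μ - ν` rearranges to `σ⁺ + ν = σ⁻ + μ`, an identity of positive
measures, on which integration is additive. This frees later computations from the Jordan
decomposition. -/
theorem signedIntegral_of_eq_sub {σ : SignedMeasure X} (μ ν : Measure X) [IsFiniteMeasure μ]
    [IsFiniteMeasure ν] (h : σ = μ.toSignedMeasure - ν.toSignedMeasure) {f : X → ℝ} {C : ℝ}
    (hf : Measurable f) (hC : ∀ x, |f x| ≤ C) :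
    signedIntegral σ f = ∫ x, f x ∂μ - ∫ x, f x ∂ν := by
  have h1 : σ.toJordanDecomposition.posPart + ν = σ.toJordanDecomposition.negPart + μ := by
    rw [← Measure.toSignedMeasure_eq_toSignedMeasure_iff, Measure.toSignedMeasure_add,
      Measure.toSignedMeasure_add]
    have h2 := SignedMeasure.toSignedMeasure_toJordanDecomposition σ
    rw [JordanDecomposition.toSignedMeasure, h, sub_eq_sub_iff_add_eq_add] at h2
    rw [← h] at h2
    rw [h2, add_comm]
  have hi := fun (μ : Measure X) [IsFiniteMeasure μ] => integrable_of_abs_le (μ := μ) hf hC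
  have h3 : ∫ x, f x ∂(σ.toJordanDecomposition.posPart + ν)
      = ∫ x, f x ∂(σ.toJordanDecomposition.negPart + μ) := by rw [h1]
  rw [integral_add_measure (hi _) (hi _), integral_add_measure (hi _) (hi _)] at h3
  rw [signedIntegral]
  linarith

theorem signedIntegral_toSignedMeasure (μ : Measure X) [IsFiniteMeasure μ] {f : X → ℝ} {C : ℝ}
    (hf : Measurable f) (hC : ∀ x, |f x| ≤ C) :
    signedIntegral μ.toSignedMeasure f = ∫ x, f x ∂μ := by
  rw [signedIntegral_of_eq_sub μ 0 (by simp) hf hC]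
  simp

theorem integral_bind_kernel {Y : Type*} [MeasurableSpace Y] (p : Kernel Y X) [IsMarkovKernel p]
    (μ : Measure Y) [IsFiniteMeasure μ] {f : X → ℝ} (hf : Integrable f (μ.bind p)) :
    ∫ x, f x ∂(μ.bind p) = ∫ s, ∫ x, f x ∂(p s) ∂μ := by
  have h : μ.bind p = (p ∘ₖ Kernel.const Unit μ) () := by
    rw [Kernel.comp_apply, Kernel.const_apply]
  rw [h] at hf ⊢
  rw [Kernel.integral_comp hf, Kernel.const_apply]

theorem measurable_integral_kernel {Y : Type*} [MeasurableSpace Y] (p : Kernel Y X)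
    [IsMarkovKernel p] {f : X → ℝ} (hf : Measurable f) : Measurable fun s => ∫ x, f x ∂(p s) :=
  (hf.stronglyMeasurable.integral_kernel (κ := p)).measurable

theorem abs_integral_kernel_le {Y : Type*} [MeasurableSpace Y] (p : Kernel Y X)
    [IsMarkovKernel p] {f : X → ℝ} {C : ℝ} (hC : ∀ x, |f x| ≤ C) (s : Y) :
    |∫ x, f x ∂(p s)| ≤ C := by
  have := norm_integral_le_of_norm_le_const (μ := p s) (f := f) (C := C) (Eventually.of_forall hC)
  simpa using this

theorem signedIntegral_withDensity {μ : Measure X} {g : X → ℝ} (hg : Integrable g μ) {f : X → ℝ}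
    {C : ℝ} (hf : Measurable f) (hC : ∀ x, |f x| ≤ C) :
    signedIntegral (μ.withDensityᵥ g) f = ∫ x, g x * f x ∂μ := by
  have : IsFiniteMeasure (μ.withDensity fun x => ENNReal.ofReal (g x)) :=
    isFiniteMeasure_withDensity_ofReal hg.2
  have : IsFiniteMeasure (μ.withDensity fun x => ENNReal.ofReal (-g x)) :=
    isFiniteMeasure_withDensity_ofReal hg.neg.2
  rw [signedIntegral_of_eq_sub _ _
    (withDensityᵥ_eq_withDensity_pos_part_sub_withDensity_neg_part hg) hf hC,
    integral_withDensity_eq_integral_toReal_smul₀ hg.1.aemeasurable.ennreal_ofReal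
      (Eventually.of_forall fun x => ENNReal.ofReal_lt_top),
    integral_withDensity_eq_integral_toReal_smul₀ (f := fun x => ENNReal.ofReal (-g x))
      hg.neg.1.aemeasurable.ennreal_ofReal (Eventually.of_forall fun x => ENNReal.ofReal_lt_top), ← integral_sub]
  · refine integral_congr_ae (Eventually.of_forall fun x => ?_)
    simp only [smul_eq_mul]
    rw [← sub_mul, ENNReal.toReal_ofReal', ENNReal.toReal_ofReal']
    congr 1
    rcases le_total 0 (g x) with h | h
    · simp [h]
    · simp [h]
  · refine (hg.pos_part.mul_bdd (c := C) hf.aestronglyMeasurable (Eventually.of_forall hC)).congr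
      (Eventually.of_forall fun x => ?_)
    simp [ENNReal.toReal_ofReal']
  · refine (hg.neg.pos_part.mul_bdd (c := C) hf.aestronglyMeasurable
      (Eventually.of_forall hC)).congr (Eventually.of_forall fun x => ?_)
    simp [ENNReal.toReal_ofReal']

theorem signedIntegral_mixture (p : Kernel ℝ X) [IsMarkovKernel p] (η : SignedMeasure ℝ)
    {f : X → ℝ} {C : ℝ} (hf : Measurable f) (hC : ∀ x, |f x| ≤ C) :
    signedIntegral (mixture p η) f = signedIntegral η fun s => ∫ x, f x ∂(p s) := by
  rw [signedIntegral_of_eq_sub (σ := mixture p η) _ _ rfl hf hC, integral_bind_kernel _ _ (integrable_of_abs_le hf hC),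
    integral_bind_kernel _ _ (integrable_of_abs_le hf hC), signedIntegral]

end SignedIntegral

/-! ### Embeddings of mixtures of the process -/

section DriftMean

variable {X : Type*} [MeasurableSpace X] {H : Type*} [NormedAddCommGroup H]
  [InnerProductSpace ℝ H] [CompleteSpace H] [RKHS ℝ H X ℝ]

variable (H) in
/-- The kernel embedding `∫ g(s) μ_{p_s} ds` of a weighted mixture of the process. -/
def driftMean (p : Kernel ℝ X) [IsMarkovKernel p] (a b : ℝ) (g : ℝ → ℝ) : H :=
  kernelMean H (mixture p ((volume.restrict (Ioo a b)).withDensityᵥ g))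

variable (H) in
/-- The kernel of `H` is measurable and bounded. -/
structure IsBoundedKernel : Prop where
  measurable : Measurable (Function.uncurry (scalarKernel (X := X) H))
  bounded : ∃ C, ∀ x : X, scalarKernel H x x < C

namespace IsBoundedKernel

theorem exists_abs_apply_le (hK : IsBoundedKernel (X := X) H) :
    ∃ C, 0 ≤ C ∧ ∀ (h : H) (x : X), |h x| ≤ C * ‖h‖ :=
  ⟨_, Real.sqrt_nonneg _, fun h x => norm_apply_le_of_bounded hK.bounded.choose_spec h x⟩

theorem measurable_apply (hK : IsBoundedKernel (X := X) H) (h : H) : Measurable fun x => h x :=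
  Drift.measurable_apply hK.measurable h

theorem inner_kernelMean_measure (hK : IsBoundedKernel (X := X) H) (μ : Measure X)
    [IsFiniteMeasure μ] (h : H) :
    inner ℝ (kernelMean H μ.toSignedMeasure) h = ∫ x, h x ∂μ := by
  obtain ⟨C, -, hC⟩ := hK.exists_abs_apply_le
  rw [inner_kernelMean hK.measurable hK.bounded,
    signedIntegral_toSignedMeasure μ (hK.measurable_apply h) (hC h)]

theorem measurable_inner (hK : IsBoundedKernel (X := X) H) (p : Kernel ℝ X) [IsMarkovKernel p]
    (h : H) : Measurable fun t => inner ℝ (kernelMean H (p t).toSignedMeasure) h := by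
  simp only [hK.inner_kernelMean_measure]
  exact measurable_integral_kernel p (hK.measurable_apply h)

theorem exists_abs_inner_le (hK : IsBoundedKernel (X := X) H) (p : Kernel ℝ X)
    [IsMarkovKernel p] : ∃ C, 0 ≤ C ∧ ∀ (h : H) (t : ℝ),
      |inner ℝ (kernelMean H (p t).toSignedMeasure) h| ≤ C * ‖h‖ := by
  obtain ⟨C, h0, hC⟩ := hK.exists_abs_apply_le
  refine ⟨C, h0, fun h t => ?_⟩
  rw [hK.inner_kernelMean_measure]
  exact abs_integral_kernel_le p (hC h) t

theorem integrable_mul_inner (hK : IsBoundedKernel (X := X) H) (p : Kernel ℝ X)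
    [IsMarkovKernel p] {μ : Measure ℝ} {g : ℝ → ℝ} (hg : Integrable g μ) (h : H) :
    Integrable (fun s => g s * inner ℝ (kernelMean H (p s).toSignedMeasure) h) μ := by
  obtain ⟨C, -, hC⟩ := hK.exists_abs_inner_le p
  exact hg.mul_bdd (c := C * ‖h‖) (hK.measurable_inner p h).aestronglyMeasurable
    (Eventually.of_forall (hC h))

theorem memLp_inner (hK : IsBoundedKernel (X := X) H) (p : Kernel ℝ X)
    [IsMarkovKernel p] {μ : Measure ℝ} [IsFiniteMeasure μ] (h : H) :
    MemLp (fun s => inner ℝ (kernelMean H (p s).toSignedMeasure) h) 2 μ := by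
  obtain ⟨C, -, hC⟩ := hK.exists_abs_inner_le p
  exact MemLp.of_bound (hK.measurable_inner p h).aestronglyMeasurable (C * ‖h‖)
    (Eventually.of_forall (hC h))

/-- This formula characterises the mixture as a weak integral, and nearly all later facts on
`driftMean` go through it. Integrability of `g` is the right assumption, since a weight need not be
square integrable. -/
theorem inner_driftMean (hK : IsBoundedKernel (X := X) H) (p : Kernel ℝ X) [IsMarkovKernel p]
    {a b : ℝ} {g : ℝ → ℝ} (hg : IntegrableOn g (Ioo a b)) (h : H) :
    inner ℝ (driftMean H p a b g) h
      = ∫ s in Ioo a b, g s * inner ℝ (kernelMean H (p s).toSignedMeasure) h := by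
  obtain ⟨C, -, hC⟩ := hK.exists_abs_apply_le
  rw [driftMean, inner_kernelMean hK.measurable hK.bounded,
    signedIntegral_mixture p _ (hK.measurable_apply h) (hC h),
    signedIntegral_withDensity hg (measurable_integral_kernel p (hK.measurable_apply h))
      (fun s => abs_integral_kernel_le p (hC h) s)]
  simp only [hK.inner_kernelMean_measure]

/-- The factorisation of the integral operator through `H`, valid at every single `t` and not only
almost everywhere. -/
theorem integral_autoCorr_mul (hK : IsBoundedKernel (X := X) H) (p : Kernel ℝ X)
    [IsMarkovKernel p] {a b : ℝ} {g : ℝ → ℝ} (hg : IntegrableOn g (Ioo a b)) (t : ℝ) :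
    ∫ s in Ioo a b, autoCorr H p t s * g s
      = inner ℝ (driftMean H p a b g) (kernelMean H (p t).toSignedMeasure) := by
  rw [hK.inner_driftMean p hg]
  refine integral_congr_ae (Eventually.of_forall fun s => ?_)
  simp only [autoCorr]
  rw [real_inner_comm, mul_comm]

theorem kernelMean_sub (hK : IsBoundedKernel (X := X) H) (μ ν : Measure X) [IsFiniteMeasure μ]
    [IsFiniteMeasure ν] : kernelMean H (μ.toSignedMeasure - ν.toSignedMeasure)
      = kernelMean H μ.toSignedMeasure - kernelMean H ν.toSignedMeasure := by
  obtain ⟨C, -, hC⟩ := hK.exists_abs_apply_le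
  refine ext_inner_right ℝ fun h => ?_
  rw [inner_kernelMean hK.measurable hK.bounded, inner_sub_left, hK.inner_kernelMean_measure,
    hK.inner_kernelMean_measure,
    signedIntegral_of_eq_sub μ ν rfl (hK.measurable_apply h) (hC h)]

end IsBoundedKernel

end DriftMean

/-! ### Orthonormal systems in Hilbert spaces -/

theorem hasSum_inner_sq_of_mem {E : Type*} [NormedAddCommGroup E] [InnerProductSpace ℝ E]
    [CompleteSpace E] {ι : Type*} {e : ι → E} (he : Orthonormal ℝ e) {v : E}
    (hv : ∀ h, (∀ i, inner ℝ (e i) h = 0) → inner ℝ v h = 0) :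
    HasSum (fun i => inner ℝ v (e i) ^ 2) (‖v‖ ^ 2) := by
  -- The vectors added to reach a Hilbert basis are orthogonal to all `e i`, hence to `v` by `hv`,
  -- and drop out of Parseval's identity.
  obtain ⟨w, B, hw, hB⟩ := he.toSubtypeRange.exists_hilbertBasis_extension
  have h1 := B.hasSum_inner_mul_inner v v
  rw [real_inner_self_eq_norm_sq] at h1
  have hinj : Function.Injective fun i => (⟨e i, hw ⟨i, rfl⟩⟩ : w) := fun i j hij =>
    he.linearIndependent.injective (Subtype.ext_iff.1 hij)
  rw [← hinj.hasSum_iff] at h1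
  · have h2 : (fun i => inner ℝ v (e i) ^ 2) = (fun x => inner ℝ v (B x) * inner ℝ (B x) v) ∘
        fun i => (⟨e i, hw ⟨i, rfl⟩⟩ : w) := by
      funext i
      simp only [Function.comp_apply, hB]
      rw [real_inner_comm (e i) v, pow_two]
    rw [h2]
    exact h1
  · intro x hx
    have hx' : ∀ i, inner ℝ (e i) (x : E) = 0 := by
      intro i
      have h2 := B.orthonormal.2 (i := ⟨e i, hw ⟨i, rfl⟩⟩) (j := x) (fun h => hx ⟨i, h⟩)
      simpa only [hB] using h2
    simp only [hB]
    rw [hv _ hx', zero_mul]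

/-- Distinct members are at distance `√2`, so the balls of radius `1 / 2` around them are disjoint,
and a separable space has only countably many disjoint nonempty open sets. -/
theorem countable_of_orthonormal {E : Type*} [NormedAddCommGroup E] [InnerProductSpace ℝ E]
    [SeparableSpace E] {ι : Type*} {e : ι → E} (he : Orthonormal ℝ e) : Countable ι := by
  refine Pairwise.countable_of_isOpen_disjoint (s := fun i => Metric.ball (e i) (1 / 2)) ?_
    (fun i => Metric.isOpen_ball) (fun i => ⟨e i, Metric.mem_ball_self (by norm_num)⟩)
  intro i j hij
  refine Metric.ball_disjoint_ball ?_
  have h := norm_sub_sq_real (e i) (e j)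
  rw [he.1 i, he.1 j, he.2 hij] at h
  rw [dist_eq_norm]
  nlinarith [norm_nonneg (e i - e j)]

theorem inner_toLp {α : Type*} [MeasurableSpace α] {μ : Measure α} {f g : α → ℝ}
    (hf : MemLp f 2 μ) (hg : MemLp g 2 μ) :
    inner ℝ (hf.toLp f) (hg.toLp g) = ∫ t, f t * g t ∂μ := by
  rw [L2.inner_def]
  refine integral_congr_ae ?_
  filter_upwards [hf.coeFn_toLp, hg.coeFn_toLp] with t h1 h2
  rw [h1, h2]
  simp [mul_comm]

/-! ### Parseval's identity for an eigensystem -/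

section Eigensystem

variable {X : Type*} [MeasurableSpace X] {H : Type*} [NormedAddCommGroup H]
  [InnerProductSpace ℝ H] [CompleteSpace H] [RKHS ℝ H X ℝ]
  {p : Kernel ℝ X} [IsMarkovKernel p] {a b : ℝ}

theorem IsEigenfunction.integrableOn {K : ℝ → ℝ → ℝ} {lam : ℝ} {f : ℝ → ℝ}
    (hf : IsEigenfunction K a b lam f) : IntegrableOn f (Ioo a b) :=
  hf.memLp.integrable one_le_two

theorem IsEigenfunction.inner_kernelMean (hK : IsBoundedKernel (X := X) H) {lam : ℝ} {f : ℝ → ℝ}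
    (hf : IsEigenfunction (autoCorr H p) a b lam f) {t : ℝ} (ht : t ∈ Ioo a b) :
    inner ℝ (kernelMean H (p t).toSignedMeasure) (driftMean H p a b f) = lam * f t := by
  rw [← hf.eigen t ht, hK.integral_autoCorr_mul p hf.integrableOn, real_inner_comm]

theorem IsEigenfunction.inner_driftMean (hK : IsBoundedKernel (X := X) H) {lam : ℝ} {f : ℝ → ℝ}
    (hf : IsEigenfunction (autoCorr H p) a b lam f) {g : ℝ → ℝ} (hg : IntegrableOn g (Ioo a b)) :
    inner ℝ (driftMean H p a b g) (driftMean H p a b f) = lam * ∫ s in Ioo a b, g s * f s := by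
  rw [hK.inner_driftMean p hg, ← integral_const_mul]
  refine setIntegral_congr_fun measurableSet_Ioo fun s hs => ?_
  simp only [hf.inner_kernelMean hK hs]
  ring

variable {ι : Type} {lam : ι → ℝ} {f : ι → ℝ → ℝ}

namespace IsEigensystem

/-- With `f i` normalised, `lam i` is the squared norm of `driftMean H p a b (f i)`. -/
theorem eigenvalue_pos (hK : IsBoundedKernel (X := X) H)
    (hs : IsEigensystem (autoCorr H p) a b lam f) (i : ι) : 0 < lam i := by
  have h := (hs.eigenfunction i).inner_driftMean hK (hs.eigenfunction i).integrableOn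
  simp only [← pow_two, hs.normalized i, mul_one] at h
  rw [real_inner_self_eq_norm_sq] at h
  exact lt_of_le_of_ne (h ▸ sq_nonneg _) (hs.eigenvalue_ne_zero i).symm

variable (H p a b lam f) in
/-- The orthonormal system in `H` that corresponds to a system of eigenfunctions. -/
def basisVector (i : ι) : H := (√(lam i))⁻¹ • driftMean H p a b (f i)

theorem inner_basisVector (hK : IsBoundedKernel (X := X) H)
    (hs : IsEigensystem (autoCorr H p) a b lam f) {g : ℝ → ℝ} (hg : IntegrableOn g (Ioo a b))
    (i : ι) : inner ℝ (driftMean H p a b g) (basisVector H p a b lam f i)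
      = √(lam i) * ∫ s in Ioo a b, g s * f i s := by
  have hp := hs.eigenvalue_pos hK i
  rw [basisVector, inner_smul_right, (hs.eigenfunction i).inner_driftMean hK hg, ← mul_assoc]
  congr 1
  rw [inv_mul_eq_div, Real.div_sqrt]

theorem orthonormal_basisVector (hK : IsBoundedKernel (X := X) H)
    (hs : IsEigensystem (autoCorr H p) a b lam f) :
    Orthonormal ℝ (basisVector H p a b lam f) := by
  classical
  rw [orthonormal_iff_ite]
  intro i j
  have hp := Real.sqrt_pos.2 (hs.eigenvalue_pos hK i)
  rw [basisVector, inner_smul_left, hs.inner_basisVector hK (hs.eigenfunction i).integrableOn]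
  split_ifs with h
  · subst h
    simp only [← pow_two, hs.normalized i]
    simp [hp.ne']
  · rw [hs.orthogonal i j h]
    simp

/-- A weighted mixture of the process is in the closed span of the system. -/
theorem inner_driftMean_eq_zero (hK : IsBoundedKernel (X := X) H)
    (hs : IsEigensystem (autoCorr H p) a b lam f) {h : H}
    (hh : ∀ i, inner ℝ (basisVector H p a b lam f i) h = 0) {g : ℝ → ℝ}
    (hg : IntegrableOn g (Ioo a b)) : inner ℝ (driftMean H p a b g) h = 0 := by
  -- In the notation `S`, `S*` this is `F = S h`. It is orthogonal to all `f i`, so completeness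
  -- gives `S S* F = 0`.
  set F : ℝ → ℝ := fun s => inner ℝ (kernelMean H (p s).toSignedMeasure) h with hF
  have hFm : MemLp F 2 (volume.restrict (Ioo a b)) := hK.memLp_inner p h
  have hFi : IntegrableOn F (Ioo a b) := hFm.integrable one_le_two
  have h1 : ∀ i, ∫ t in Ioo a b, f i t * F t = 0 := by
    intro i
    have h2 := hh i
    have hp := Real.sqrt_pos.2 (hs.eigenvalue_pos hK i)
    rw [basisVector, inner_smul_left, hK.inner_driftMean p (hs.eigenfunction i).integrableOn] at h2
    simpa [hp.ne'] using h2
  have h2 := hs.complete F hFm h1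
  simp only [hK.integral_autoCorr_mul p hFi] at h2
  -- `‖S* F‖² = ⟪F, S S* F⟫ = 0`; then `‖F‖² = ⟪S* F, h⟫ = 0`, so `F` vanishes almost everywhere and
  -- pairs to zero with every integrable `g`.
  have h3 : driftMean H p a b F = 0 := by
    rw [← inner_self_eq_zero (𝕜 := ℝ), hK.inner_driftMean p hFi]
    refine integral_eq_zero_of_ae ?_
    filter_upwards [h2] with t ht
    rw [real_inner_comm, ht]
    simp
  have h4 : ∫ s in Ioo a b, F s * F s = 0 := by
    rw [← hK.inner_driftMean p hFi, h3, inner_zero_left]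
  have h5 : F =ᵐ[volume.restrict (Ioo a b)] 0 := by
    rw [integral_eq_zero_iff_of_nonneg (fun s => mul_self_nonneg _)
      (MemLp.integrable_mul hFm hFm)] at h4
    filter_upwards [h4] with t ht
    simpa using ht
  rw [hK.inner_driftMean p hg]
  refine integral_eq_zero_of_ae ?_
  filter_upwards [h5] with t ht
  simp only [hF] at ht
  simp [ht]

/-- Orthogonality to the system passes from mixtures to their span, so Bessel's inequality is an
equality there. -/
theorem hasSum_inner_basisVector (hK : IsBoundedKernel (X := X) H)
    (hs : IsEigensystem (autoCorr H p) a b lam f) {v : H}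
    (hv : v ∈ Submodule.span ℝ (driftMean H p a b '' {g | IntegrableOn g (Ioo a b)})) :
    HasSum (fun i => inner ℝ v (basisVector H p a b lam f i) ^ 2) (‖v‖ ^ 2) := by
  refine hasSum_inner_sq_of_mem (hs.orthonormal_basisVector hK) fun h hh => ?_
  induction hv using Submodule.span_induction with
  | mem x hx =>
    obtain ⟨g, hg, rfl⟩ := hx
    exact hs.inner_driftMean_eq_zero hK hh hg
  | zero => exact inner_zero_left _
  | add x y _ _ hx hy => rw [inner_add_left, hx, hy, add_zero]
  | smul c x _ hx => rw [inner_smul_left, hx, mul_zero]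

theorem hasSum_sq_norm_driftMean (hK : IsBoundedKernel (X := X) H)
    (hs : IsEigensystem (autoCorr H p) a b lam f) {g : ℝ → ℝ} (hg : IntegrableOn g (Ioo a b)) :
    HasSum (fun i => lam i * (∫ s in Ioo a b, g s * f i s) ^ 2) (‖driftMean H p a b g‖ ^ 2) := by
  have h := hs.hasSum_inner_basisVector hK (Submodule.subset_span ⟨g, hg, rfl⟩)
  simp only [hs.inner_basisVector hK hg, mul_pow] at h
  simpa only [Real.sq_sqrt (hs.eigenvalue_pos hK _).le] using h

/-- `L²(a, b)` is separable. Countability is needed for dominated convergence along the finite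
subsets of `ι`. -/
theorem countable {K : ℝ → ℝ → ℝ} (hs : IsEigensystem K a b lam f) : Countable ι := by
  classical
  have h : Orthonormal ℝ fun i => (hs.eigenfunction i).memLp.toLp (f i) := by
    rw [orthonormal_iff_ite]
    intro i j
    rw [inner_toLp]
    split_ifs with h
    · subst h
      simp only [← pow_two, hs.normalized i]
    · exact hs.orthogonal i j h
  have : Fact ((2 : ENNReal) ≠ ⊤) := ⟨by simp⟩
  exact countable_of_orthonormal h

end IsEigensystem

end Eigensystem

/-! ### Compactness and the existence of an eigensystem -/

theorem exists_orthonormal_eigenvectors {E : Type} [NormedAddCommGroup E] [InnerProductSpace ℝ E]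
    [CompleteSpace E] {T : E →L[ℝ] E} (hT : IsCompactOperator T)
    (hT' : (T : E →ₗ[ℝ] E).IsSymmetric) :
    ∃ (ι : Type) (lam : ι → ℝ) (v : ι → E), (∀ i, lam i ≠ 0) ∧ Orthonormal ℝ v ∧
      (∀ i, T (v i) = lam i • v i) ∧ ∀ g, (∀ i, inner ℝ (v i) g = 0) → T g = 0 := by
  have hfin : ∀ μ : {μ : ℝ // μ ≠ 0}, FiniteDimensional ℝ (Module.End.eigenspace T.toLinearMap μ) :=
    fun μ => ContinuousLinearMap.finite_dimensional_eigenspace hT μ.1 μ.2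
  let B := fun μ : {μ : ℝ // μ ≠ 0} =>
    stdOrthonormalBasis ℝ (Module.End.eigenspace T.toLinearMap (μ : ℝ))
  -- All nonzero reals may be indexed: over one that is not an eigenvalue the fibre is `Fin 0`.
  refine ⟨Σ μ : {μ : ℝ // μ ≠ 0},
    Fin (Module.finrank ℝ (Module.End.eigenspace T.toLinearMap (μ : ℝ))), fun i => i.1,
    fun i => (B i.1 i.2 : E), fun i => i.1.2,
    (hT'.orthogonalFamily_eigenspaces.comp Subtype.val_injective).orthonormal_sigma_orthonormal
      (fun μ => (B μ).orthonormal),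
    fun i => Module.End.mem_eigenspace_iff.1 (B i.1 i.2).2, fun g hg => ?_⟩
  -- By symmetry `⟪z, T g⟫ = μ ⟪z, g⟫` for `z` in the eigenspace of `μ`. This vanishes for `μ = 0`
  -- trivially and otherwise because `g` is orthogonal to the chosen basis. The eigenspaces of a
  -- compact symmetric operator have trivial common complement.
  have h1 : T g ∈ (⨆ μ, Module.End.eigenspace T.toLinearMap μ)ᗮ := by
    rw [← Submodule.iInf_orthogonal, Submodule.mem_iInf]
    intro μ
    rw [Submodule.mem_orthogonal]
    intro z hz
    have h2 : inner ℝ z (T g) = μ * inner ℝ z g := by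
      have h3 := hT' z g
      rw [ContinuousLinearMap.coe_coe] at h3
      have h4 : T z = μ • z := Module.End.mem_eigenspace_iff.1 hz
      rw [← h3, h4, inner_smul_left]
      rfl
    rw [h2]
    by_cases hμ : μ = 0
    · rw [hμ, zero_mul]
    · have h5 : z = ∑ j, (B ⟨μ, hμ⟩).repr ⟨z, hz⟩ j • (B ⟨μ, hμ⟩ j : E) := by
        have h6 := congrArg Subtype.val ((B ⟨μ, hμ⟩).sum_repr ⟨z, hz⟩)
        simpa using h6.symm
      rw [h5, sum_inner, Finset.sum_eq_zero, mul_zero]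
      intro j _
      rw [inner_smul_left, hg ⟨⟨μ, hμ⟩, j⟩, mul_zero]
  rw [ContinuousLinearMap.orthogonalComplement_iSup_eigenspaces_eq_bot hT hT'] at h1
  exact (Submodule.mem_bot ℝ).1 h1

section Spectral

variable {X : Type*} [MeasurableSpace X] {H : Type*} [NormedAddCommGroup H]
  [InnerProductSpace ℝ H] [CompleteSpace H] [RKHS ℝ H X ℝ]

namespace IsBoundedKernel

theorem driftMean_congr (hK : IsBoundedKernel (X := X) H) (p : Kernel ℝ X) [IsMarkovKernel p]
    {a b : ℝ} {g g' : ℝ → ℝ} (hg : IntegrableOn g (Ioo a b))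
    (h : g =ᵐ[volume.restrict (Ioo a b)] g') : driftMean H p a b g = driftMean H p a b g' := by
  refine ext_inner_right ℝ fun v => ?_
  rw [hK.inner_driftMean p hg, hK.inner_driftMean p (hg.congr h)]
  refine integral_congr_ae ?_
  filter_upwards [h] with t ht
  rw [ht]

/-- The map that sends `h` to the function `t ↦ ∫ h dp_t` in `L²`. -/
def evalL2 (hK : IsBoundedKernel (X := X) H) (p : Kernel ℝ X) [IsMarkovKernel p] (a b : ℝ) :
    H →L[ℝ] Lp ℝ 2 (volume.restrict (Ioo a b)) :=
  LinearMap.mkContinuousOfExistsBound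
    { toFun := fun h => (hK.memLp_inner p h).toLp _
      map_add' := fun g h => by
        rw [← MemLp.toLp_add]
        congr 1
        funext t
        simp [inner_add_right]
      map_smul' := fun c h => by
        rw [RingHom.id_apply, ← MemLp.toLp_const_smul]
        congr 1
        funext t
        simp [inner_smul_right] }
    (by
      obtain ⟨C, hC0, hC⟩ := hK.exists_abs_inner_le p
      refine ⟨(measureUnivNNReal (volume.restrict (Ioo a b)) : ℝ) ^ (ENNReal.toReal 2)⁻¹ * C,
        fun h => ?_⟩
      have h1 := Lp.norm_le_of_ae_bound (p := 2) (μ := volume.restrict (Ioo a b))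
        (f := (hK.memLp_inner p h).toLp _) (C := C * ‖h‖) (by positivity) (by
          filter_upwards [(hK.memLp_inner p (μ := volume.restrict (Ioo a b)) h).coeFn_toLp]
            with t ht
          rw [ht]
          exact hC h t)
      exact h1.trans (le_of_eq (mul_assoc _ _ _).symm))

theorem coeFn_evalL2 (hK : IsBoundedKernel (X := X) H) (p : Kernel ℝ X) [IsMarkovKernel p]
    {a b : ℝ} (h : H) : hK.evalL2 p a b h =ᵐ[volume.restrict (Ioo a b)]
      fun t => inner ℝ (kernelMean H (p t).toSignedMeasure) h :=
  (hK.memLp_inner p h).coeFn_toLp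

theorem adjoint_evalL2 (hK : IsBoundedKernel (X := X) H) (p : Kernel ℝ X) [IsMarkovKernel p]
    {a b : ℝ} (g : Lp ℝ 2 (volume.restrict (Ioo a b))) :
    (hK.evalL2 p a b).adjoint g = driftMean H p a b g := by
  refine ext_inner_right ℝ fun v => ?_
  rw [ContinuousLinearMap.adjoint_inner_left,
    hK.inner_driftMean p ((Lp.memLp g).integrable one_le_two), L2.inner_def]
  refine integral_congr_ae ?_
  filter_upwards [hK.coeFn_evalL2 p v] with t ht
  rw [ht]
  simp [mul_comm]

/-- The integral operator with kernel `K_{t,s}` on `L²`. -/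
def corrOperator (hK : IsBoundedKernel (X := X) H) (p : Kernel ℝ X) [IsMarkovKernel p] (a b : ℝ) :
    Lp ℝ 2 (volume.restrict (Ioo a b)) →L[ℝ] Lp ℝ 2 (volume.restrict (Ioo a b)) :=
  hK.evalL2 p a b ∘L (hK.evalL2 p a b).adjoint

theorem coeFn_corrOperator (hK : IsBoundedKernel (X := X) H) (p : Kernel ℝ X) [IsMarkovKernel p]
    {a b : ℝ} (g : Lp ℝ 2 (volume.restrict (Ioo a b))) :
    hK.corrOperator p a b g =ᵐ[volume.restrict (Ioo a b)]
      fun t => inner ℝ (kernelMean H (p t).toSignedMeasure) (driftMean H p a b g) := by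
  rw [corrOperator, ContinuousLinearMap.comp_apply, hK.adjoint_evalL2 p g]
  exact hK.coeFn_evalL2 p _

theorem isSymmetric_corrOperator (hK : IsBoundedKernel (X := X) H) (p : Kernel ℝ X)
    [IsMarkovKernel p] (a b : ℝ) :
    (hK.corrOperator p a b : Lp ℝ 2 (volume.restrict (Ioo a b)) →ₗ[ℝ] _).IsSymmetric := by
  intro x y
  exact (ContinuousLinearMap.adjoint_inner_right (hK.evalL2 p a b) _ y).symm.trans
    (ContinuousLinearMap.adjoint_inner_left (hK.evalL2 p a b) _ x)

/-- Dominated convergence on a finite measure space. This is what improves weak convergence to norm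
convergence in the compactness proof. -/
theorem tendsto_evalL2 (hK : IsBoundedKernel (X := X) H) (p : Kernel ℝ X) [IsMarkovKernel p]
    {a b : ℝ} {h : ℕ → H} {h' : H} {R : ℝ} (hR : ∀ n, ‖h n‖ ≤ R)
    (hh : ∀ t, Tendsto (fun n => inner ℝ (kernelMean H (p t).toSignedMeasure) (h n)) atTop
      (𝓝 (inner ℝ (kernelMean H (p t).toSignedMeasure) h'))) :
    Tendsto (fun n => hK.evalL2 p a b (h n)) atTop (𝓝 (hK.evalL2 p a b h')) := by
  rw [tendsto_iff_norm_sub_tendsto_zero]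
  have key : Tendsto (fun n => ‖hK.evalL2 p a b (h n) - hK.evalL2 p a b h'‖ ^ 2) atTop (𝓝 0) := by
    have h1 : ∀ n, ‖hK.evalL2 p a b (h n) - hK.evalL2 p a b h'‖ ^ 2 =
        ∫ t in Ioo a b, (inner ℝ (kernelMean H (p t).toSignedMeasure) (h n - h')) ^ 2 := by
      intro n
      rw [← map_sub, ← real_inner_self_eq_norm_sq, L2.inner_def]
      refine integral_congr_ae ?_
      filter_upwards [hK.coeFn_evalL2 p (h n - h')] with t ht
      rw [ht]
      simp
    simp only [h1]
    obtain ⟨C, hC0, hC⟩ := hK.exists_abs_inner_le p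
    have h2 := tendsto_integral_of_dominated_convergence
      (μ := volume.restrict (Ioo a b))
      (F := fun n t => (inner ℝ (kernelMean H (p t).toSignedMeasure) (h n - h')) ^ 2)
      (f := fun _ => 0) (fun _ => (C * (R + ‖h'‖)) ^ 2)
      (fun n => ((hK.measurable_inner p _).pow_const 2).aestronglyMeasurable)
      (integrable_const _)
      (fun n => Eventually.of_forall fun t => by
        rw [norm_pow]
        refine pow_le_pow_left₀ (norm_nonneg _) ((hC _ t).trans ?_) 2
        gcongr
        exact (norm_sub_le _ _).trans (by gcongr; exact hR n))
      (Eventually.of_forall fun t => by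
        have h3 := ((hh t).sub_const (inner ℝ (kernelMean H (p t).toSignedMeasure) h')).pow 2
        simpa [inner_sub_right] using h3)
    simpa using h2
  have h4 := key.sqrt
  simpa [Real.sqrt_sq] using h4

/-- The unit ball of the separable space `L²` is weakly sequentially compact. If `g_n` converges
weakly, `⟪μ_t, S* g_n⟫` converges for each `t`, and `tendsto_evalL2` makes `S S* g_n` converge in
norm. -/
theorem isCompactOperator_corrOperator (hK : IsBoundedKernel (X := X) H) (p : Kernel ℝ X)
    [IsMarkovKernel p] (a b : ℝ) : IsCompactOperator (hK.corrOperator p a b) := by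
  have : Fact ((2 : ENNReal) ≠ ⊤) := ⟨by simp⟩
  set E := Lp ℝ 2 (volume.restrict (Ioo a b))
  rw [isCompactOperator_iff_exists_mem_nhds_image_subset_compact]
  refine ⟨Metric.closedBall 0 1, Metric.closedBall_mem_nhds _ one_pos, _, ?_, subset_rfl⟩
  refine IsSeqCompact.isCompact fun y hy => ?_
  choose g hg hgy using hy
  obtain ⟨l, hl, φ, hφ, hlim⟩ := WeakDual.isSeqCompact_closedBall ℝ E 0 1
    (x := fun n => StrongDual.toWeakDual (InnerProductSpace.toDual ℝ E (g n))) (fun n => by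
      have := hg n
      simpa using this)
  obtain ⟨g', hg'⟩ := (InnerProductSpace.toDual ℝ E).surjective (WeakDual.toStrongDual l)
  have hev : ∀ x : E, Tendsto (fun n => inner ℝ (g (φ n)) x) atTop (𝓝 (inner ℝ g' x)) := by
    intro x
    have h1 := ((WeakDual.eval_continuous (𝕜 := ℝ) x).tendsto l).comp hlim
    have h2 : l x = inner ℝ g' x := by
      have h3 : WeakDual.toStrongDual l x = InnerProductSpace.toDual ℝ E g' x := by rw [hg']
      simpa using h3
    rw [h2] at h1
    simpa [Function.comp_def] using h1
  refine ⟨hK.corrOperator p a b g', ⟨g', ?_, rfl⟩, φ, hφ, ?_⟩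
  · have : WeakDual.toStrongDual l ∈ Metric.closedBall 0 1 := hl
    rw [← hg'] at this
    simpa using this
  · have h1 : (y ∘ φ) = fun n => hK.evalL2 p a b ((hK.evalL2 p a b).adjoint (g (φ n))) := by
      funext n
      rw [Function.comp_apply, ← hgy]
      rfl
    rw [h1]
    refine hK.tendsto_evalL2 p (R := ‖(hK.evalL2 p a b).adjoint‖) (fun n => ?_) (fun t => ?_)
    · refine ((hK.evalL2 p a b).adjoint.le_opNorm _).trans ?_
      have h2 := hg (φ n)
      rw [mem_closedBall_zero_iff] at h2
      exact mul_le_of_le_one_right (norm_nonneg _) h2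
    · have h3 := hev (hK.evalL2 p a b (kernelMean H (p t).toSignedMeasure))
      have h4 : ∀ x, inner ℝ (kernelMean H (p t).toSignedMeasure)
          ((hK.evalL2 p a b).adjoint x)
            = inner ℝ x (hK.evalL2 p a b (kernelMean H (p t).toSignedMeasure)) := fun x => by
        rw [ContinuousLinearMap.adjoint_inner_right, real_inner_comm]
      have h5 := h3.congr fun n => (h4 (g (φ n))).symm
      rw [← h4 g'] at h5
      exact h5

end IsBoundedKernel

theorem exists_isEigensystem (hK : IsBoundedKernel (X := X) H) (p : Kernel ℝ X)
    [IsMarkovKernel p] (a b : ℝ) : ∃ (ι : Type) (_ : Countable ι) (lam : ι → ℝ) (f : ι → ℝ → ℝ),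
      IsEigensystem (autoCorr H p) a b lam f := by
  obtain ⟨ι, lam, v, hlam, hv, hTv, hcompl⟩ := exists_orthonormal_eigenvectors
    (hK.isCompactOperator_corrOperator p a b) (hK.isSymmetric_corrOperator p a b)
  set T := hK.corrOperator p a b with hT
  -- An eigenvector in `L²` is only a class of functions. This representative is defined at each `t`
  -- by the eigenvalue equation, which therefore holds everywhere on the interval.
  let f : ι → ℝ → ℝ := fun i t =>
    (lam i)⁻¹ * inner ℝ (kernelMean H (p t).toSignedMeasure) (driftMean H p a b (v i))
  have hfL : ∀ i, MemLp (f i) 2 (volume.restrict (Ioo a b)) := fun i =>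
    (hK.memLp_inner p _).const_mul _
  have hfv : ∀ i, f i =ᵐ[volume.restrict (Ioo a b)] v i := by
    intro i
    have h1 := hK.coeFn_corrOperator p (v i)
    rw [← hT, hTv] at h1
    filter_upwards [h1, Lp.coeFn_smul (lam i) (v i)] with t h2 h3
    simp only [f]
    rw [← h2, h3]
    simp [hlam i]
  have hfLv : ∀ i, (hfL i).toLp (f i) = v i := fun i => by
    rw [← Lp.toLp_coeFn (v i) (Lp.memLp _)]
    exact (MemLp.toLp_eq_toLp_iff _ _).2 (hfv i)
  have hsys : IsEigensystem (autoCorr H p) a b lam f := by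
    refine ⟨fun i => ⟨hfL i, fun h0 => ?_, fun t ht => ?_⟩, hlam, fun i => ?_, fun i j hij => ?_,
      fun g hg hgo => ?_⟩
    · have h1 : v i = 0 := (Lp.eq_zero_iff_ae_eq_zero).2 ((hfv i).symm.trans h0)
      exact hv.ne_zero i h1
    · have hfi : IntegrableOn (f i) (Ioo a b) := (hfL i).integrable one_le_two
      rw [hK.integral_autoCorr_mul p hfi, hK.driftMean_congr p hfi (hfv i), real_inner_comm]
      simp only [f]
      rw [mul_inv_cancel_left₀ (hlam i)]
    · have h1 := inner_toLp (hfL i) (hfL i)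
      rw [hfLv, real_inner_self_eq_norm_sq, hv.1 i] at h1
      simp only [pow_two, ← h1]
      norm_num
    · rw [← inner_toLp (hfL i) (hfL j), hfLv, hfLv]
      exact hv.2 hij
    · have hgo' : ∀ i, inner ℝ (v i) (hg.toLp g) = 0 := by
        intro i
        rw [← hfLv i, inner_toLp]
        exact hgo i
      have hTG : T (hg.toLp g) = 0 := hcompl _ hgo'
      have hgi : IntegrableOn g (Ioo a b) := hg.integrable one_le_two
      have h1 := hK.coeFn_corrOperator p (hg.toLp g)
      rw [← hT, hTG, ← hK.driftMean_congr p hgi hg.coeFn_toLp.symm] at h1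
      filter_upwards [h1, Lp.coeFn_zero ℝ 2 (volume.restrict (Ioo a b))] with t h2 h3
      rw [hK.integral_autoCorr_mul p hgi, real_inner_comm, ← h2, h3]
      rfl
  exact ⟨ι, hsys.countable, lam, f, hsys⟩

end Spectral

/-! ### Uniform boundedness of signed measures on chains of sets -/

section Nikodym

theorem continuous_tsum_bool {x : ℕ → ℝ} (hx : Summable x) :
    Continuous fun c : ℕ → Bool => ∑' j, if c j then x j else 0 := by
  refine continuous_tsum (u := fun j => |x j|) (fun j => ?_) hx.abs (fun j c => ?_)
  · exact (continuous_of_discreteTopology (f := fun β : Bool => if β then x j else 0)).comp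
      (continuous_apply j)
  · split_ifs <;> simp

theorem tsum_bool_eq_sum {x : ℕ → ℝ} {c : ℕ → Bool} {k : ℕ} (hc : ∀ j, k ≤ j → c j = false) :
    (∑' j, if c j then x j else 0) = ∑ j ∈ Finset.range k, if c j then x j else 0 := by
  refine tsum_eq_sum fun j hj => ?_
  rw [Finset.mem_range, not_lt] at hj
  simp [hc j hj]

/-- Summable sequences that are bounded on each set of indices have uniformly bounded partial
sums. -/
theorem exists_abs_partialSum_le {ι : Type*} {x : ι → ℕ → ℝ} (hx : ∀ i, Summable (x i))
    (hS : ∀ c : ℕ → Bool, ∃ M : ℝ, ∀ i, |∑' j, if c j then x i j else 0| ≤ M) :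
    ∃ M, ∀ i k, |∑ j ∈ Finset.range k, x i j| ≤ M := by
  -- These closed sets cover the compact space `{0,1}^ℕ`. By Baire one of them has an interior
  -- point, hence contains a cylinder: all `c` that agree with `c₀` on the first `K` coordinates.
  let F : ℕ → Set (ℕ → Bool) := fun N => {c | ∀ i, |∑' j, if c j then x i j else 0| ≤ N}
  have hF : ∀ N, IsClosed (F N) := by
    intro N
    simp only [F, ofPred_forall]
    exact isClosed_iInter fun i => isClosed_le (continuous_tsum_bool (hx i)).abs continuous_const
  have hU : ⋃ N, F N = univ := by
    refine eq_univ_of_forall fun c => ?_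
    obtain ⟨M, hM⟩ := hS c
    obtain ⟨N, hN⟩ := exists_nat_ge M
    exact mem_iUnion.2 ⟨N, fun i => (hM i).trans hN⟩
  obtain ⟨N, c₀, hc₀⟩ := nonempty_interior_of_iUnion_of_closed hF hU
  obtain ⟨I, u, hu, hI⟩ := isOpen_pi_iff.1 isOpen_interior c₀ hc₀
  obtain ⟨K, hK⟩ := I.exists_nat_subset_range
  have hmem : ∀ c : ℕ → Bool, (∀ j < K, c j = c₀ j) → ∀ i, |∑' j, if c j then x i j else 0| ≤ N := by
    intro c hc
    refine interior_subset (hI fun j hj => ?_)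
    rw [hc j (Finset.mem_range.1 (hK hj))]
    exact (hu j hj).2
  choose M hM using fun k : ℕ => hS fun j => decide (j < k)
  have hM' : ∀ i k, |∑ j ∈ Finset.range k, x i j| ≤ M k := by
    intro i k
    have h := hM k i
    rw [tsum_bool_eq_sum (k := k) (by simp)] at h
    refine le_of_eq_of_le ?_ h
    congr 1
    refine Finset.sum_congr rfl fun j hj => ?_
    simp [Finset.mem_range.1 hj]
  -- The first term bounds the partial sums of length at most `K`. The block from `K` to `K + m` is
  -- the difference of the sums for two points of the cylinder, hence at most `2 * N`.
  refine ⟨(∑ k ∈ Finset.range (K + 1), |M k|) + 2 * N, fun i k => ?_⟩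
  have hK' : ∀ k ≤ K, |∑ j ∈ Finset.range k, x i j| ≤ ∑ k ∈ Finset.range (K + 1), |M k| :=
    fun k hk => ((hM' i k).trans (le_abs_self _)).trans
      (Finset.single_le_sum (f := fun k => |M k|) (fun _ _ => abs_nonneg _)
        (Finset.mem_range.2 (by omega)))
  rcases le_total k K with hk | hk
  · have := hK' k hk
    have : (0 : ℝ) ≤ N := N.cast_nonneg
    linarith
  · obtain ⟨m, rfl⟩ := Nat.exists_eq_add_of_le hk
    have h1 := hmem (fun j => if j < K then c₀ j else false) (fun j hj => by simp [hj]) i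
    have h2 := hmem (fun j => if j < K then c₀ j else decide (j < K + m))
      (fun j hj => by simp [hj]) i
    rw [tsum_bool_eq_sum (k := K + m)
      (fun j hj => by rw [if_neg (by omega)])] at h1
    rw [tsum_bool_eq_sum (k := K + m)
      (fun j hj => by rw [if_neg (by omega)]; simp; omega)] at h2
    rw [Finset.sum_range_add] at h1 h2 ⊢
    have h3 : ∑ j ∈ Finset.range m, (if (if K + j < K then c₀ (K + j) else
        decide (K + j < K + m)) = true then x i (K + j) else 0)
        = ∑ j ∈ Finset.range m, x i (K + j) := by
      refine Finset.sum_congr rfl fun j hj => ?_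
      simp [Finset.mem_range.1 hj]
    have h4 : ∑ j ∈ Finset.range m, (if (if K + j < K then c₀ (K + j) else
        false) = true then x i (K + j) else 0) = 0 := by
      refine Finset.sum_eq_zero fun j hj => ?_
      simp
    have h5 : ∑ j ∈ Finset.range K, (if (if j < K then c₀ j else
        decide (j < K + m)) = true then x i j else 0)
        = ∑ j ∈ Finset.range K, (if (if j < K then c₀ j else false) = true then x i j else 0) := by
      refine Finset.sum_congr rfl fun j hj => ?_
      simp [Finset.mem_range.1 hj]
    rw [h3, h5] at h2
    rw [h4] at h1
    have h6 := hK' K le_rfl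
    rw [abs_le] at h1 h2 h6 ⊢
    constructor <;> linarith

variable {X : Type*} [MeasurableSpace X]

/-- The values on `E k` are partial sums of the values on the disjoint differences of the chain. The
union of any subfamily of these differences is measurable, so boundedness on single sets is exactly
the hypothesis of `exists_abs_partialSum_le`. -/
theorem exists_abs_le_of_monotone {ι : Type*} {σ : ι → SignedMeasure X}
    (hσ : ∀ A, MeasurableSet A → ∃ M : ℝ, ∀ i, |σ i A| ≤ M) {E : ℕ → Set X}
    (hE : ∀ k, MeasurableSet (E k)) (hm : Monotone E) : ∃ M, ∀ i k, |σ i (E k)| ≤ M := by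
  have hD : ∀ k, MeasurableSet (disjointed E k) := fun k => .disjointed hE k
  have hsum : ∀ i (c : ℕ → Bool), HasSum (fun j => if c j then σ i (disjointed E j) else 0)
      (σ i (⋃ j, if c j then disjointed E j else ∅)) := by
    intro i c
    have h := (σ i).hasSum_of_disjoint_iUnion (f := fun j => if c j then disjointed E j else ∅)
      (fun j => by split_ifs; exacts [hD j, .empty]) (fun j k hjk => by
        have := disjoint_disjointed E hjk
        simp only [Function.onFun]
        split_ifs <;> simp_all)
    have h1 : (fun j => if c j then σ i (disjointed E j) else 0)
        = fun j => σ i (if c j then disjointed E j else ∅) := by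
      funext j
      split_ifs <;> simp
    rw [h1]
    exact h
  have hpart : ∀ i k, ∑ j ∈ Finset.range (k + 1), σ i (disjointed E j) = σ i (E k) := by
    intro i k
    induction k with
    | zero => simp
    | succ k ih =>
      rw [Finset.sum_range_succ, ih, hm.disjointed_add_one,
        VectorMeasure.of_add_of_sdiff (hE k) (hE (k + 1)) (hm k.le_succ)]
  obtain ⟨M, hM⟩ := exists_abs_partialSum_le (x := fun i j => σ i (disjointed E j))
    (fun i => by simpa using (hsum i fun _ => true).summable) (fun c => by
      obtain ⟨M, hM⟩ := hσ (⋃ j, if c j then disjointed E j else ∅)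
        (.iUnion fun j => by split_ifs; exacts [hD j, .empty])
      exact ⟨M, fun i => by rw [(hsum i c).tsum_eq]; exact hM i⟩)
  exact ⟨M, fun i k => by rw [← hpart]; exact hM i (k + 1)⟩

theorem exists_abs_le_of_antitone {ι : Type*} {σ : ι → SignedMeasure X}
    (hσ : ∀ A, MeasurableSet A → ∃ M : ℝ, ∀ i, |σ i A| ≤ M) {E : ℕ → Set X}
    (hE : ∀ k, MeasurableSet (E k)) (hm : Antitone E) : ∃ M, ∀ i k, |σ i (E k)| ≤ M := by
  obtain ⟨M, hM⟩ := exists_abs_le_of_monotone hσ (fun k => (hE k).compl)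
    (fun j k hjk => compl_subset_compl.2 (hm hjk))
  obtain ⟨M', hM'⟩ := hσ univ .univ
  refine ⟨M + M', fun i k => ?_⟩
  have h := VectorMeasure.of_add_of_sdiff (v := σ i) (hE k) .univ (subset_univ _)
  rw [← compl_eq_univ_sdiff] at h
  have h1 := hM i k
  have h2 := hM' i
  rw [abs_le] at h1 h2 ⊢
  constructor <;> linarith

/-- Signed measures that are bounded on each measurable set are uniformly bounded on the
superlevel sets of a function. -/
theorem exists_abs_superlevel_le {ι : Type*} {σ : ι → SignedMeasure X}
    (hσ : ∀ A, MeasurableSet A → ∃ M : ℝ, ∀ i, |σ i A| ≤ M) {h : X → ℝ} (hh : Measurable h) :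
    ∃ M, ∀ i (u : ℝ), |σ i {x | u ≤ h x}| ≤ M := by
  by_contra! hcon
  choose i u hu using fun n : ℕ => hcon n
  have hE : ∀ u : ℝ, MeasurableSet {x | u ≤ h x} := fun u => measurableSet_le measurable_const hh
  -- Any sequence of levels has a monotone subsequence, along which the superlevel sets form a
  -- monotone chain of sets. The uniform bound there contradicts the choice of `u`.
  obtain ⟨g, hg⟩ := exists_increasing_or_nonincreasing_subseq (· ≤ ·) u
  have key : ∃ M, ∀ i k, |σ i {x | u (g k) ≤ h x}| ≤ M := by
    rcases hg with hg | hg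
    · refine exists_abs_le_of_antitone hσ (fun k => hE _) fun j k hjk x hx => ?_
      have h1 : u (g j) ≤ u (g k) := by
        rcases hjk.eq_or_lt with rfl | h2
        exacts [le_rfl, hg j k h2]
      exact h1.trans hx
    · refine exists_abs_le_of_monotone hσ (fun k => hE _) fun j k hjk x hx => ?_
      have h1 : u (g k) ≤ u (g j) := by
        rcases hjk.eq_or_lt with rfl | h2
        exacts [le_rfl, (not_le.1 (hg j k h2)).le]
      exact h1.trans hx
  obtain ⟨M, hM⟩ := key
  obtain ⟨N, hN⟩ := exists_nat_ge M
  have h1 := hu (g N)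
  have h2 := hM (i (g N)) N
  have h3 : (N : ℝ) ≤ g N := Nat.cast_le.2 (g.strictMono.le_apply)
  linarith

end Nikodym

/-! ### Classical differentiability of integrals -/

section Classical

variable {X : Type*} [MeasurableSpace X]

/-- Layer cake formula for a bounded function. -/
theorem integral_eq_integral_superlevel {μ : Measure X} [IsProbabilityMeasure μ] {h : X → ℝ}
    {B : ℝ} (hh : Measurable h) (hB : ∀ x, |h x| ≤ B) :
    ∫ x, h x ∂μ = (∫ u in Ioc 0 (2 * B), μ.real {x | u ≤ h x + B}) - B := by
  have hi := integrable_of_abs_le (μ := μ) hh hB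
  have h1 := (hi.add (integrable_const B)).integral_eq_integral_Ioc_meas_le (M := 2 * B)
    (Eventually.of_forall fun x => by
      have := (abs_le.1 (hB x)).1
      simp only [Pi.zero_apply, Pi.add_apply]
      linarith)
    (Eventually.of_forall fun x => by
      have := (abs_le.1 (hB x)).2
      simp only [Pi.add_apply]
      linarith)
  simp only [Pi.add_apply] at h1
  rw [← h1, integral_add hi (integrable_const B)]
  simp

theorem measurable_real_superlevel (μ : Measure X) [IsFiniteMeasure μ] (h : X → ℝ) (B : ℝ) :
    Measurable fun u => μ.real {x | u ≤ h x + B} :=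
  Antitone.measurable fun _ _ huv => measureReal_mono fun _ hx => huv.trans hx

/-- The derivative is taken under the integral over levels. The difference quotients are signed
measures that converge on each measurable set; boundedness on each set then gives one constant for
all superlevel sets, which dominates. -/
theorem ClassicallyDifferentiable.differentiableOn_integral {p : Kernel ℝ X} [IsMarkovKernel p]
    {a b : ℝ} (hp : ClassicallyDifferentiable p a b) {h : X → ℝ} {B : ℝ} (hh : Measurable h)
    (hB : ∀ x, |h x| ≤ B) : DifferentiableOn ℝ (fun t => ∫ x, h x ∂(p t)) (Ioo a b) := by
  intro t ht
  have hE : ∀ u : ℝ, MeasurableSet {x | u ≤ h x + B} := fun u =>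
    measurableSet_le measurable_const (hh.add_const B)
  have hd : ∀ A, MeasurableSet A →
      HasDerivAt (fun t => (p t).real A) (deriv (fun t => (p t).real A) t) t := fun A hA =>
    ((hp A hA).differentiableAt (isOpen_Ioo.mem_nhds ht)).hasDerivAt
  suffices hs : HasDerivAt (fun t => ∫ x, h x ∂(p t))
      (∫ u in Ioc 0 (2 * B), deriv (fun t => (p t).real {x | u ≤ h x + B}) t) t from
    hs.differentiableAt.differentiableWithinAt
  rw [hasDerivAt_iff_tendsto_slope]
  -- Along a sequence, convergence implies boundedness of all terms, as the uniform boundedness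
  -- lemma requires.
  refine tendsto_of_seq_tendsto fun τ hτ => ?_
  have hseq : ∀ A, MeasurableSet A → Tendsto (fun n => slope (fun t => (p t).real A) t (τ n)) atTop
      (𝓝 (deriv (fun t => (p t).real A) t)) := fun A hA =>
    (hasDerivAt_iff_tendsto_slope.1 (hd A hA)).comp hτ
  let σ : ℕ → SignedMeasure X := fun n =>
    (τ n - t)⁻¹ • ((p (τ n)).toSignedMeasure - (p t).toSignedMeasure)
  have hσ : ∀ n A, MeasurableSet A → σ n A = slope (fun t => (p t).real A) t (τ n) := by
    intro n A hA
    simp only [σ, slope_def_field, smul_apply, sub_apply,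
      Measure.toSignedMeasure_apply_measurable hA, smul_eq_mul]
    rw [inv_mul_eq_div]
  obtain ⟨M, hM⟩ := exists_abs_superlevel_le (σ := σ) (fun A hA => by
    obtain ⟨M, hM⟩ := (Metric.isBounded_range_of_tendsto _ (hseq A hA)).exists_norm_le
    exact ⟨M, fun n => by rw [hσ n A hA]; exact hM _ ⟨n, rfl⟩⟩) (hh.add_const B)
  have hslope : ∀ n, slope (fun t => ∫ x, h x ∂(p t)) t (τ n)
      = ∫ u in Ioc 0 (2 * B), slope (fun t => (p t).real {x | u ≤ h x + B}) t (τ n) := by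
    intro n
    have hi : ∀ t, IntegrableOn (fun u => (p t).real {x | u ≤ h x + B}) (Ioc 0 (2 * B)) :=
      fun t => Measure.integrableOn_of_bounded (M := 1) measure_Ioc_lt_top.ne
        (measurable_real_superlevel (p t) h B).aestronglyMeasurable
        (Eventually.of_forall fun u => by
          rw [Real.norm_of_nonneg measureReal_nonneg]; exact measureReal_le_one)
    simp only [slope_def_field, integral_eq_integral_superlevel hh hB]
    rw [integral_div, integral_sub (hi _) (hi _)]
    ring
  refine Tendsto.congr (fun n => (hslope n).symm) ?_
  refine tendsto_integral_of_dominated_convergence (fun _ => M) (fun n => ?_)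
    (integrable_const _) (fun n => ?_) ?_
  · simp only [slope_def_field]
    exact (((measurable_real_superlevel _ h B).sub
      (measurable_real_superlevel _ h B)).div_const _).aestronglyMeasurable
  · refine Eventually.of_forall fun u => ?_
    rw [← hσ n _ (hE u)]
    exact hM n u
  · exact Eventually.of_forall fun u => hseq _ (hE u)

end Classical

/-! ### Test functions and distributional derivatives -/

section TestFunctions

variable {a b : ℝ}

/-- A smooth function with compact support in `(a, b)` as a test function. -/
def testFunction (φ : ℝ → ℝ) (h1 : ContDiff ℝ ∞ φ) (h2 : HasCompactSupport φ)
    (h3 : tsupport φ ⊆ Ioo a b) : 𝓓(timeDomain a b, ℝ) := ⟨φ, h1, h2, h3⟩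

theorem differentiable_testFunction (φ : 𝓓(timeDomain a b, ℝ)) : Differentiable ℝ φ :=
  φ.contDiff.differentiable (by simp)

theorem continuous_deriv_testFunction (φ : 𝓓(timeDomain a b, ℝ)) : Continuous (deriv φ) :=
  φ.contDiff.continuous_deriv (by simp)

theorem integrable_testFunction (φ : 𝓓(timeDomain a b, ℝ)) : Integrable φ :=
  φ.continuous.integrable_of_hasCompactSupport φ.hasCompactSupport

theorem integrable_deriv_testFunction (φ : 𝓓(timeDomain a b, ℝ)) : Integrable (deriv φ) :=
  (continuous_deriv_testFunction φ).integrable_of_hasCompactSupport φ.hasCompactSupport.deriv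

theorem integral_deriv_testFunction (φ : 𝓓(timeDomain a b, ℝ)) : ∫ t, deriv φ t = 0 :=
  integral_eq_zero_of_hasDerivAt_of_integrable
    (fun t => (differentiable_testFunction φ t).hasDerivAt)
    (integrable_deriv_testFunction φ) (integrable_testFunction φ)

theorem exists_Icc_of_isCompact {K : Set ℝ} (hK : IsCompact K) (h : K ⊆ Ioo a b) :
    ∃ c d, a < c ∧ d < b ∧ K ⊆ Icc c d := by
  rcases K.eq_empty_or_nonempty with rfl | hne
  -- For empty `K` the endpoints are arbitrary; `c ≤ d` is not claimed.
  · exact ⟨a + 1, b - 1, by linarith, by linarith, empty_subset _⟩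
  · exact ⟨sInf K, sSup K, (h (hK.sInf_mem hne)).1, (h (hK.sSup_mem hne)).2,
      fun x hx => ⟨csInf_le hK.bddBelow hx, le_csSup hK.bddAbove hx⟩⟩

theorem exists_Icc_testFunction (φ : 𝓓(timeDomain a b, ℝ)) : ∃ c d, a < c ∧ d < b ∧
    (∀ t, t ∉ Icc c d → φ t = 0) ∧ ∀ t, t ∉ Icc c d → deriv φ t = 0 := by
  obtain ⟨c, d, hc, hd, h⟩ := exists_Icc_of_isCompact φ.hasCompactSupport φ.tsupport_subset
  exact ⟨c, d, hc, hd, fun t ht => image_eq_zero_of_notMem_tsupport fun h1 => ht (h h1),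
    fun t ht => image_eq_zero_of_notMem_tsupport fun h1 => ht (h (tsupport_deriv_subset h1))⟩

theorem locallyIntegrableOn_of_Icc {f : ℝ → ℝ}
    (h : ∀ c d, a < c → d < b → IntegrableOn f (Icc c d)) : LocallyIntegrableOn f (Ioo a b) := by
  rw [locallyIntegrableOn_iff isOpen_Ioo.isLocallyClosed]
  intro K hK hKc
  obtain ⟨c, d, hc, hd, h1⟩ := exists_Icc_of_isCompact hKc hK
  exact (h c d hc hd).mono_set h1

theorem integrableOn_Icc_of_locallyIntegrableOn {f : ℝ → ℝ} (h : LocallyIntegrableOn f (Ioo a b))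
    {c d : ℝ} (hc : a < c) (hd : d < b) : IntegrableOn f (Icc c d) :=
  h.integrableOn_compact_subset (fun _ ht => ⟨hc.trans_le ht.1, ht.2.trans_lt hd⟩) isCompact_Icc

/-- Every locally integrable function has a distributional derivative. -/
theorem exists_isDistribDeriv {f : ℝ → ℝ} (hf : LocallyIntegrableOn f (Ioo a b)) :
    ∃ D : 𝓓'(timeDomain a b, ℝ), IsDistribDeriv a b f D := by
  let I : 𝓓(timeDomain a b, ℝ) →L[ℝ] ℝ :=
    TestFunction.integralAgainstBilinCLM (ContinuousLinearMap.mul ℝ ℝ) volume f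
  let L : 𝓓(timeDomain a b, ℝ) →L[ℝ] 𝓓(timeDomain a b, ℝ) := TestFunction.lineDerivCLM ℝ (1 : ℝ)
  refine ⟨(-(I ∘L L) : 𝓓(timeDomain a b, ℝ) →L[ℝ] ℝ), hf, fun φ => ?_⟩
  have h1 : ∀ t, L φ t = deriv φ t := fun t => by
    simp only [L]
    rw [TestFunction.lineDerivCLM_apply_of_le le_top]
    exact (differentiable_testFunction φ t).lineDeriv_eq_fderiv.trans (by simp)
  have h2 : I (L φ) = ∫ t, f t * deriv φ t := by
    have h3 : LocallyIntegrableOn f (timeDomain a b : Set ℝ) := hf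
    simp only [I, TestFunction.integralAgainstBilinCLM_eq_integral h3]
    refine integral_congr_ae (Eventually.of_forall fun t => ?_)
    simp [h1, mul_comm]
  rw [← h2]
  rfl

end TestFunctions

/-! ### Mollification -/

section Mollifier

/-- A smooth bump function with support of radius `1 / (n + 1)` and integral one. -/
def mollifier (n : ℕ) : ℝ → ℝ :=
  ContDiffBump.normed (c := (0 : ℝ)) ⟨1 / (2 * (n + 1)), 1 / (n + 1), by positivity, by
    have : (0 : ℝ) < n + 1 := by positivity
    gcongr
    linarith⟩ volume

theorem contDiff_mollifier (n : ℕ) : ContDiff ℝ ∞ (mollifier n) :=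
  ContDiffBump.contDiff_normed _

theorem hasCompactSupport_mollifier (n : ℕ) : HasCompactSupport (mollifier n) :=
  ContDiffBump.hasCompactSupport_normed _

theorem mollifier_nonneg (n : ℕ) (x : ℝ) : 0 ≤ mollifier n x :=
  ContDiffBump.nonneg_normed _ _

theorem integral_mollifier (n : ℕ) : ∫ x, mollifier n x = 1 :=
  ContDiffBump.integral_normed _

theorem continuous_deriv_mollifier (n : ℕ) : Continuous (deriv (mollifier n)) :=
  (contDiff_mollifier n).continuous_deriv (by simp)

theorem integrable_mollifier (n : ℕ) : Integrable (mollifier n) :=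
  (contDiff_mollifier n).continuous.integrable_of_hasCompactSupport (hasCompactSupport_mollifier n)

theorem integrable_deriv_mollifier (n : ℕ) : Integrable (deriv (mollifier n)) :=
  (continuous_deriv_mollifier n).integrable_of_hasCompactSupport
    (hasCompactSupport_mollifier n).deriv

theorem support_mollifier (n : ℕ) :
    Function.support (mollifier n) = Metric.ball 0 (1 / (n + 1)) :=
  ContDiffBump.support_normed_eq _

/-- Convergence holds at Lebesgue points, provided that the ratio of outer to inner radius stays
bounded; here it is always `2`. -/
theorem ae_tendsto_mollifier {g : ℝ → ℝ} (hg : Integrable g) :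
    ∀ᵐ t, Tendsto (fun n => ∫ s, mollifier n (t - s) * g s) atTop (𝓝 (g t)) := by
  have h := ContDiffBump.ae_convolution_tendsto_right_of_locallyIntegrable (μ := volume)
    (φ := fun n : ℕ => (⟨1 / (2 * (n + 1)), 1 / (n + 1), by positivity, by
      have : (0 : ℝ) < n + 1 := by positivity
      gcongr
      linarith⟩ : ContDiffBump (0 : ℝ))) (l := atTop) (K := 2)
    tendsto_one_div_add_atTop_nhds_zero_nat (Eventually.of_forall fun n => by
      have : (0 : ℝ) < n + 1 := by positivity
      refine le_of_eq ?_
      field_simp) hg.locallyIntegrable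
  filter_upwards [h] with t ht
  simp only [convolution_eq_swap] at ht
  exact ht

theorem integral_abs_mollifier_le {g : ℝ → ℝ} (hg : Integrable g) (n : ℕ) :
    ∫ t, |∫ s, mollifier n (t - s) * g s| ≤ ∫ s, |g s| := by
  have h1 := integral_convolution (ContinuousLinearMap.lsmul ℝ ℝ) (integrable_mollifier n) hg.abs
  simp only [convolution_eq_swap, ContinuousLinearMap.lsmul_apply, smul_eq_mul,
    integral_mollifier, one_mul] at h1
  rw [← h1]
  have h2 := (integrable_mollifier n).integrable_convolution (ContinuousLinearMap.lsmul ℝ ℝ) hg.abs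
  refine integral_mono_of_nonneg (Eventually.of_forall fun t => abs_nonneg _) ?_
    (Eventually.of_forall fun t => ?_)
  · refine h2.congr (Eventually.of_forall fun t => ?_)
    rw [convolution_eq_swap]
    rfl
  · refine (abs_integral_le_integral_abs).trans (le_of_eq ?_)
    refine integral_congr_ae (Eventually.of_forall fun s => ?_)
    simp only [abs_mul, abs_of_nonneg (mollifier_nonneg n _)]

/-- For `t` in `[c, d]` and small radius, `s ↦ mollifier n (t - s)` is a test function supported
halfway between `[c, d]` and the endpoints `a`, `b`. The sign from differentiating in `s` cancels
the sign in the weak derivative. -/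
theorem IsWeakDeriv.integral_deriv_mollifier {a b : ℝ} {q g : ℝ → ℝ} (hg : IsWeakDeriv a b q g)
    {c d : ℝ} (hc : a < c) (hd : d < b) {n : ℕ} (h1 : (1 : ℝ) / (n + 1) ≤ (c - a) / 2)
    (h2 : (1 : ℝ) / (n + 1) ≤ (b - d) / 2) {t : ℝ} (ht : t ∈ Icc c d) :
    ∫ s, deriv (mollifier n) (t - s) * q s
      = ∫ s, mollifier n (t - s) * (Icc ((a + c) / 2) ((d + b) / 2)).indicator g s := by
  have hsupp : Function.support (fun s => mollifier n (t - s)) ⊆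
      Icc ((a + c) / 2) ((d + b) / 2) := by
    intro s hs
    have h3 : t - s ∈ Function.support (mollifier n) := hs
    rw [support_mollifier, mem_ball_zero_iff, Real.norm_eq_abs, abs_lt] at h3
    constructor <;> linarith [h3.1, h3.2, ht.1, ht.2]
  have htsupp : tsupport (fun s => mollifier n (t - s)) ⊆
      Icc ((a + c) / 2) ((d + b) / 2) := closure_minimal hsupp isClosed_Icc
  have h4 : ∫ s, g s * mollifier n (t - s) = -∫ s, q s * deriv (fun s => mollifier n (t - s)) s :=
    hg.2.2 (testFunction (fun s => mollifier n (t - s))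
    ((contDiff_mollifier n).comp (contDiff_const.sub contDiff_id))
    (isCompact_Icc.of_isClosed_subset (isClosed_tsupport _) htsupp)
    (htsupp.trans fun s hs => ⟨by linarith [hs.1], by linarith [hs.2]⟩))
  simp only [deriv_comp_const_sub] at h4
  have h5 : ∫ s, deriv (mollifier n) (t - s) * q s = ∫ s, g s * mollifier n (t - s) := by
    rw [h4, ← integral_neg]
    refine integral_congr_ae (Eventually.of_forall fun s => ?_)
    ring
  rw [h5]
  refine integral_congr_ae (Eventually.of_forall fun s => ?_)
  by_cases hs : s ∈ Icc ((a + c) / 2) ((d + b) / 2)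
  · simp only [indicator_of_mem hs, mul_comm]
  · have h6 : mollifier n (t - s) = 0 := by
      by_contra h7
      exact hs (hsupp h7)
    simp [h6]

end Mollifier

/-! ### Signed mixtures of a Markov kernel -/

section KernelMeasure

/-- The signed measure `A ↦ ∫ F(z) κ_z(A) dν(z)`. -/
def kernelMeasure {X Z : Type*} [MeasurableSpace X] [MeasurableSpace Z] (κ : Kernel Z X)
    [IsMarkovKernel κ] {ν : Measure Z} {F : Z → ℝ} (hF : Integrable F ν) : SignedMeasure X where
  measureOf' A := open Classical in if MeasurableSet A then ∫ z, F z * (κ z).real A ∂ν else 0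
  empty' := by simp
  not_measurable' A hA := by simp [hA]
  m_iUnion' E hE hd := by
    simp only [hE, MeasurableSet.iUnion hE, if_true]
    have hs : ∀ z, HasSum (fun n => (κ z).real (E n)) ((κ z).real (⋃ n, E n)) := by
      intro z
      have h := (κ z).toSignedMeasure.hasSum_of_disjoint_iUnion hE hd
      simpa only [Measure.toSignedMeasure_apply_measurable (hE _),
        Measure.toSignedMeasure_apply_measurable (MeasurableSet.iUnion hE)] using h
    have hm : ∀ A, MeasurableSet A → Measurable fun z => (κ z).real A := fun A hA =>
      (κ.measurable_coe hA).ennreal_toReal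
    refine hasSum_integral_of_dominated_convergence (fun n z => |F z| * (κ z).real (E n))
      (fun n => hF.1.mul (hm _ (hE n)).aestronglyMeasurable)
      (fun n => Eventually.of_forall fun z => by
        rw [norm_mul, Real.norm_eq_abs, Real.norm_of_nonneg measureReal_nonneg])
      (Eventually.of_forall fun z => (hs z).summable.mul_left _) ?_
      (Eventually.of_forall fun z => (hs z).mul_left _)
    simp only [fun z => ((hs z).mul_left |F z|).tsum_eq]
    exact hF.abs.mul_bdd (c := 1) (hm _ (.iUnion hE)).aestronglyMeasurable
      (Eventually.of_forall fun z => by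
        rw [Real.norm_of_nonneg measureReal_nonneg]; exact measureReal_le_one)

theorem kernelMeasure_apply {X Z : Type*} [MeasurableSpace X] [MeasurableSpace Z] (κ : Kernel Z X)
    [IsMarkovKernel κ] {ν : Measure Z} {F : Z → ℝ} (hF : Integrable F ν) {A : Set X}
    (hA : MeasurableSet A) : kernelMeasure κ hF A = ∫ z, F z * (κ z).real A ∂ν :=
  if_pos hA

end KernelMeasure

/-! ### Weak differentiability of integrals -/

section Weak

variable {X : Type*} [MeasurableSpace X]

theorem measurable_real_kernel {p : Kernel ℝ X} {A : Set X} (hA : MeasurableSet A) :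
    Measurable fun t => (p t).real A := (p.measurable_coe hA).ennreal_toReal

variable {p : Kernel ℝ X} [IsMarkovKernel p] {a b : ℝ}

theorem abs_real_kernel_le (t : ℝ) (A : Set X) : |(p t).real A| ≤ 1 := by
  rw [abs_of_nonneg measureReal_nonneg]
  exact measureReal_le_one

theorem integrable_deriv_mollifier_prod (n : ℕ) (c d : ℝ) :
    Integrable (fun z : ℝ × ℝ => deriv (mollifier n) (z.1 - z.2))
      ((volume.restrict (Icc c d)).prod volume) := by
  have hm : Continuous (fun z : ℝ × ℝ => deriv (mollifier n) (z.1 - z.2)) :=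
    (continuous_deriv_mollifier n).comp (continuous_fst.sub continuous_snd)
  rw [integrable_prod_iff hm.aestronglyMeasurable]
  refine ⟨Eventually.of_forall fun t => (integrable_deriv_mollifier n).comp_sub_left t, ?_⟩
  have h : ∀ t : ℝ, ∫ s, ‖deriv (mollifier n) (t - s)‖ = ∫ s, ‖deriv (mollifier n) s‖ := fun t =>
    integral_sub_left_eq_self (fun s => ‖deriv (mollifier n) s‖) volume t
  simp only [h]
  exact integrable_const _

/-- Mollified derivatives of `t ↦ p_t(A)`, integrated against functions bounded by one, are
uniformly bounded on superlevel sets. -/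
theorem WeaklyDifferentiable.exists_abs_integral_mollifier_le (hp : WeaklyDifferentiable p a b)
    {h : X → ℝ} (hh : Measurable h) {c d : ℝ} (hc : a < c) (hd : d < b) :
    ∃ M, ∀ n : ℕ, (1 : ℝ) / (n + 1) ≤ (c - a) / 2 → (1 : ℝ) / (n + 1) ≤ (b - d) / 2 →
      ∀ θ : ℝ → ℝ, Measurable θ → (∀ t, |θ t| ≤ 1) → ∀ u : ℝ,
        |∫ t in Icc c d, θ t * ∫ s, deriv (mollifier n) (t - s) * (p s).real {x | u ≤ h x}|
          ≤ M := by
  -- The multiplier `θ` belongs to the index, so that the bound is uniform in it as well; choosing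
  -- `θ` as a sign later yields a bound in `L¹`.
  let I := {i : ℕ × (ℝ → ℝ) // (1 : ℝ) / (i.1 + 1) ≤ (c - a) / 2 ∧
    (1 : ℝ) / (i.1 + 1) ≤ (b - d) / 2 ∧ Measurable i.2 ∧ ∀ t, |i.2 t| ≤ 1}
  have hF : ∀ i : I, Integrable
      (fun z : ℝ × ℝ => i.1.2 z.1 * deriv (mollifier i.1.1) (z.1 - z.2))
      ((volume.restrict (Icc c d)).prod volume) := fun i =>
    (integrable_deriv_mollifier_prod i.1.1 c d).bdd_mul
      (i.2.2.2.1.comp measurable_fst).aestronglyMeasurable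
      (Eventually.of_forall fun z => i.2.2.2.2 z.1)
  let σ : I → SignedMeasure X := fun i => kernelMeasure (p.comap Prod.snd measurable_snd) (hF i)
  have hσ : ∀ i A, MeasurableSet A → σ i A = ∫ t in Icc c d, i.1.2 t *
      ∫ s, deriv (mollifier i.1.1) (t - s) * (p s).real A := by
    intro i A hA
    simp only [σ, kernelMeasure_apply _ _ hA]
    rw [integral_prod]
    · simp only [Kernel.comap_apply, mul_assoc, integral_const_mul]
    · exact (hF i).mul_bdd (c := 1)
        ((measurable_real_kernel hA).comp measurable_snd).aestronglyMeasurable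
        (Eventually.of_forall fun z => abs_real_kernel_le _ _)
  obtain ⟨M, hM⟩ := exists_abs_superlevel_le (σ := σ) (fun A hA => by
    obtain ⟨g, hg⟩ := hp A hA
    have hgi : Integrable ((Icc ((a + c) / 2) ((d + b) / 2)).indicator g) :=
      (integrableOn_Icc_of_locallyIntegrableOn hg.2.1 (by linarith) (by linarith)).integrable_indicator
        measurableSet_Icc
    -- On a fixed set the mollified derivative is the mollification of the weak derivative, whose
    -- `L¹` norm does not increase.
    refine ⟨∫ s, |(Icc ((a + c) / 2) ((d + b) / 2)).indicator g s|, fun i => ?_⟩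
    obtain ⟨⟨n, θ⟩, hn1, hn2, hθ, hθ1⟩ := i
    rw [hσ _ A hA]
    simp only at hn1 hn2 hθ hθ1 ⊢
    have hconv : Integrable fun t => ∫ s, mollifier n (t - s) *
        (Icc ((a + c) / 2) ((d + b) / 2)).indicator g s := by
      have h2 := (integrable_mollifier n).integrable_convolution (ContinuousLinearMap.lsmul ℝ ℝ) hgi
      refine h2.congr (Eventually.of_forall fun t => ?_)
      rw [convolution_eq_swap]
      rfl
    refine le_trans ?_ (integral_abs_mollifier_le hgi n)
    refine abs_integral_le_integral_abs.trans ?_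
    refine le_trans ?_ (setIntegral_le_integral (s := Icc c d) hconv.abs
      (Eventually.of_forall fun t => abs_nonneg _))
    refine integral_mono_of_nonneg (Eventually.of_forall fun t => abs_nonneg _)
      hconv.abs.integrableOn ?_
    filter_upwards [ae_restrict_mem measurableSet_Icc] with t ht
    rw [hg.integral_deriv_mollifier hc hd hn1 hn2 ht, abs_mul]
    exact mul_le_of_le_one_left (abs_nonneg _) (hθ1 t)) hh
  refine ⟨M, fun n hn1 hn2 θ hθ hθ1 u => ?_⟩
  have h1 := hM ⟨(n, θ), hn1, hn2, hθ, hθ1⟩ u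
  rwa [hσ _ _ (measurableSet_le measurable_const hh)] at h1

theorem measurable_real_superlevel_prod {h : X → ℝ} (hh : Measurable h) :
    Measurable fun z : ℝ × ℝ => (p z.1).real {x | z.2 ≤ h x} := by
  have h1 := Kernel.measurable_kernel_prodMk_left (κ := p.comap Prod.fst measurable_fst)
    (t := {y : (ℝ × ℝ) × X | y.1.2 ≤ h y.2})
    (measurableSet_le (measurable_snd.comp measurable_fst) (hh.comp measurable_snd))
  exact h1.ennreal_toReal

/-- The weak derivatives of `t ↦ p_t(h ≥ u)` as a jointly measurable function. -/
theorem WeaklyDifferentiable.exists_measurable_deriv (hp : WeaklyDifferentiable p a b)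
    {h : X → ℝ} (hh : Measurable h) : ∃ G : ℝ × ℝ → ℝ, Measurable G ∧
      (∀ u, ∀ φ : 𝓓(timeDomain a b, ℝ),
        ∫ t, G (t, u) * φ t = -∫ t, (p t).real {x | u ≤ h x} * deriv φ t) ∧
      ∀ c d, a < c → d < b → ∃ M, 0 ≤ M ∧
        ∀ u, ∫⁻ t in Icc c d, ‖G (t, u)‖ₑ ≤ ENNReal.ofReal M := by
  have hE : ∀ u : ℝ, MeasurableSet {x | u ≤ h x} := fun u => measurableSet_le measurable_const hh
  choose g hg using fun u : ℝ => hp _ (hE u)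
  -- The weak derivatives `g u` are chosen separately for each level and need not be measurable in
  -- `u`. Their mollifications are computed from `p` itself and are jointly measurable.
  let Gn : ℕ → ℝ × ℝ → ℝ := fun n z =>
    ∫ s, deriv (mollifier n) (z.1 - s) * (p s).real {x | z.2 ≤ h x}
  have hGn : ∀ n, Measurable (Gn n) := by
    intro n
    have h1 : Measurable fun y : (ℝ × ℝ) × ℝ =>
        deriv (mollifier n) (y.1.1 - y.2) * (p y.2).real {x | y.1.2 ≤ h x} :=
      ((continuous_deriv_mollifier n).measurable.comp
        ((measurable_fst.comp measurable_fst).sub measurable_snd)).mul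
        ((measurable_real_superlevel_prod hh).comp
          (measurable_snd.prodMk (measurable_snd.comp measurable_fst)))
    exact (h1.stronglyMeasurable.integral_prod_right' (ν := volume)).measurable
  have hev : ∀ ε : ℝ, 0 < ε → ∀ᶠ n : ℕ in atTop, (1 : ℝ) / (n + 1) ≤ ε := fun ε hε =>
    (tendsto_one_div_add_atTop_nhds_zero_nat.eventually_lt_const hε).mono fun n hn => hn.le
  have hlim : ∀ u c d, a < c → d < b → ∀ᵐ t ∂volume.restrict (Icc c d),
      Tendsto (fun n => Gn n (t, u)) atTop (𝓝 (g u t)) := by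
    intro u c d hc hd
    have hgi : Integrable ((Icc ((a + c) / 2) ((d + b) / 2)).indicator (g u)) :=
      (integrableOn_Icc_of_locallyIntegrableOn (hg u).2.1
        (by linarith) (by linarith)).integrable_indicator measurableSet_Icc
    filter_upwards [ae_restrict_mem measurableSet_Icc,
      ae_restrict_of_ae (ae_tendsto_mollifier hgi)] with t ht h1
    rw [indicator_of_mem (show t ∈ Icc ((a + c) / 2) ((d + b) / 2) from
      ⟨by linarith [ht.1], by linarith [ht.2]⟩)] at h1
    refine h1.congr' ?_
    filter_upwards [hev ((c - a) / 2) (by linarith), hev ((b - d) / 2) (by linarith)] with n h2 h3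
    exact ((hg u).integral_deriv_mollifier hc hd h2 h3 ht).symm
  -- The upper limit is measurable without knowing where the limit exists, and agrees with `g u` for
  -- almost every `t`.
  let G : ℝ × ℝ → ℝ := fun z => limsup (fun n => Gn n z) atTop
  have hG : ∀ u c d, a < c → d < b → ∀ᵐ t ∂volume.restrict (Icc c d), G (t, u) = g u t :=
    fun u c d hc hd => (hlim u c d hc hd).mono fun t ht => ht.limsup_eq
  refine ⟨G, Measurable.limsup hGn, fun u φ => ?_, fun c d hc hd => ?_⟩
  · rw [← (hg u).2.2 φ]
    obtain ⟨c, d, hc, hd, h1, -⟩ := exists_Icc_testFunction φ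
    refine integral_congr_ae ?_
    filter_upwards [(ae_restrict_iff' measurableSet_Icc).1 (hG u c d hc hd)] with t ht
    by_cases h2 : t ∈ Icc c d
    · rw [ht h2]
    · rw [h1 t h2, mul_zero, mul_zero]
  · obtain ⟨M, hM⟩ := hp.exists_abs_integral_mollifier_le hh hc hd
    refine ⟨max M 0, le_max_right _ _, fun u => ?_⟩
    have hint : ∀ n, IntegrableOn (fun t => Gn n (t, u)) (Icc c d) := by
      intro n
      refine Measure.integrableOn_of_bounded (M := ∫ s, |deriv (mollifier n) s|)
        measure_Icc_lt_top.ne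
        ((hGn n).comp (measurable_id.prodMk measurable_const)).aestronglyMeasurable
        (Eventually.of_forall fun t => ?_)
      rw [← integral_sub_left_eq_self (fun s => |deriv (mollifier n) s|) volume t]
      refine norm_integral_le_of_norm_le
        ((integrable_deriv_mollifier n).comp_sub_left t).abs (Eventually.of_forall fun s => ?_)
      rw [norm_mul]
      exact mul_le_of_le_one_right (norm_nonneg _) (abs_real_kernel_le _ _)
    have hbound : ∀ᶠ n : ℕ in atTop,
        ∫⁻ t in Icc c d, ‖Gn n (t, u)‖ₑ ≤ ENNReal.ofReal (max M 0) := by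
      filter_upwards [hev ((c - a) / 2) (by linarith), hev ((b - d) / 2) (by linarith)] with n h2 h3
      rw [← ofReal_integral_norm_eq_lintegral_enorm (hint n)]
      refine ENNReal.ofReal_le_ofReal (le_trans ?_ (le_max_left _ _))
      have hmeas : Measurable fun t => Gn n (t, u) :=
        (hGn n).comp (measurable_id.prodMk measurable_const)
      have h4 := hM n h2 h3 (fun t => if 0 ≤ Gn n (t, u) then 1 else -1)
        (Measurable.ite (measurableSet_le measurable_const hmeas) measurable_const
          measurable_const) (fun t => by split_ifs <;> simp) u
      refine le_trans (le_of_eq ?_) ((le_abs_self _).trans h4)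
      refine integral_congr_ae (Eventually.of_forall fun t => ?_)
      change |Gn n (t, u)| = (if 0 ≤ Gn n (t, u) then 1 else -1) * Gn n (t, u)
      split_ifs with h5
      · rw [abs_of_nonneg h5, one_mul]
      · rw [abs_of_neg (not_le.1 h5), neg_one_mul]
    -- Fatou's lemma carries the uniform `L¹` bound over to the limit.
    calc ∫⁻ t in Icc c d, ‖G (t, u)‖ₑ
        = ∫⁻ t in Icc c d, liminf (fun n => ‖Gn n (t, u)‖ₑ) atTop := by
          refine lintegral_congr_ae ?_
          filter_upwards [hlim u c d hc hd] with t ht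
          have h6 : G (t, u) = g u t := ht.limsup_eq
          rw [h6, ht.enorm.liminf_eq]
      _ ≤ liminf (fun n => ∫⁻ t in Icc c d, ‖Gn n (t, u)‖ₑ) atTop :=
          lintegral_liminf_le fun n =>
            ((hGn n).comp (measurable_id.prodMk measurable_const)).enorm
      _ ≤ ENNReal.ofReal (max M 0) := liminf_le_of_frequently_le' hbound.frequently

/-- The weak derivative is the integral of `G` over levels. The `L¹` bound uniform in `u` makes `G`
integrable on the product, so Fubini may exchange levels and times. -/
theorem WeaklyDifferentiable.exists_isWeakDeriv_integral (hp : WeaklyDifferentiable p a b)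
    {h : X → ℝ} {B : ℝ} (hh : Measurable h) (hB : ∀ x, |h x| ≤ B) :
    ∃ g, IsWeakDeriv a b (fun t => ∫ x, h x ∂(p t)) g := by
  obtain ⟨G, hG, hGφ, hGM⟩ := hp.exists_measurable_deriv (hh.add_const B)
  have hint : ∀ c d, a < c → d < b →
      Integrable G ((volume.restrict (Icc c d)).prod (volume.restrict (Ioc 0 (2 * B)))) := by
    intro c d hc hd
    obtain ⟨M, hM0, hM⟩ := hGM c d hc hd
    refine ⟨hG.aestronglyMeasurable, ?_⟩
    rw [HasFiniteIntegral, lintegral_prod_symm _ hG.enorm.aemeasurable]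
    calc ∫⁻ u in Ioc 0 (2 * B), ∫⁻ t in Icc c d, ‖G (t, u)‖ₑ
        ≤ ∫⁻ u in Ioc 0 (2 * B), ENNReal.ofReal M := lintegral_mono fun u => hM u
      _ < ⊤ := by
        rw [lintegral_const]
        exact ENNReal.mul_lt_top ENNReal.ofReal_lt_top (measure_lt_top _ _)
  have hmI : Measurable fun t => ∫ x, h x ∂(p t) := measurable_integral_kernel p hh
  refine ⟨fun t => ∫ u in Ioc 0 (2 * B), G (t, u), ?_, ?_, fun φ => ?_⟩
  · exact locallyIntegrableOn_of_Icc fun c d _ _ =>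
      Measure.integrableOn_of_bounded measure_Icc_lt_top.ne hmI.aestronglyMeasurable
        (Eventually.of_forall fun t => abs_integral_kernel_le p hB t)
  · exact locallyIntegrableOn_of_Icc fun c d hc hd => (hint c d hc hd).integral_prod_left
  · obtain ⟨c, d, hc, hd, h1, -⟩ := exists_Icc_testFunction φ
    obtain ⟨Cφ, hCφ⟩ := φ.continuous.bounded_above_of_compact_support φ.hasCompactSupport
    have hzero : ∀ F : ℝ → ℝ, ∫ t, F t * φ t = ∫ t in Icc c d, F t * φ t := fun F =>
      (setIntegral_eq_integral_of_forall_compl_eq_zero fun t ht => by rw [h1 t ht, mul_zero]).symm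
    calc ∫ t, (∫ u in Ioc 0 (2 * B), G (t, u)) * φ t
        = ∫ t in Icc c d, ∫ u in Ioc 0 (2 * B), G (t, u) * φ t := by
          rw [hzero]
          simp only [integral_mul_const]
      _ = ∫ u in Ioc 0 (2 * B), ∫ t in Icc c d, G (t, u) * φ t := by
          refine integral_integral_swap ?_
          exact (hint c d hc hd).mul_bdd (c := Cφ)
            (φ.continuous.comp continuous_fst).aestronglyMeasurable
            (Eventually.of_forall fun z => hCφ _)
      _ = ∫ u in Ioc 0 (2 * B), -∫ t, (p t).real {x | u ≤ h x + B} * deriv φ t := by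
          refine integral_congr_ae (Eventually.of_forall fun u => ?_)
          simp only
          rw [← hGφ u φ, hzero]
      _ = -∫ t, ∫ u in Ioc 0 (2 * B), (p t).real {x | u ≤ h x + B} * deriv φ t := by
          rw [integral_neg, integral_integral_swap]
          have h2 : Integrable (fun z : ℝ × ℝ => deriv φ z.2)
              ((volume.restrict (Ioc 0 (2 * B))).prod volume) :=
            (integrable_deriv_testFunction φ).comp_snd _
          refine h2.bdd_mul (c := 1) ?_ (Eventually.of_forall fun z => abs_real_kernel_le _ _)
          exact ((measurable_real_superlevel_prod (hh.add_const B)).comp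
            measurable_swap).aestronglyMeasurable
      _ = -∫ t, (∫ x, h x ∂(p t)) * deriv φ t := by
          congr 1
          simp only [integral_mul_const, integral_eq_integral_superlevel hh hB, sub_mul]
          -- The constant `-B` of the layer cake formula disappears because a test function's
          -- derivative has integral zero.
          rw [integral_sub, integral_const_mul, integral_deriv_testFunction, mul_zero, sub_zero]
          · have h3 := (integrable_deriv_testFunction φ).bdd_mul (c := B + B)
              (hmI.add_const B).aestronglyMeasurable (Eventually.of_forall fun t => by
                refine (norm_add_le _ _).trans (add_le_add (abs_integral_kernel_le p hB t) ?_)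
                rw [Real.norm_of_nonneg]
                exact (abs_nonneg _).trans (abs_integral_kernel_le p hB t))
            refine h3.congr (Eventually.of_forall fun t => ?_)
            simp only [integral_eq_integral_superlevel hh hB]
            ring
          · exact (integrable_deriv_testFunction φ).const_mul B

end Weak

/-! ### Weights and integration by parts -/

namespace IsWeight

variable {w W : ℝ → ℝ}

theorem continuous (hw : IsWeight w W) : Continuous W := by
  have h : W = fun y => W 0 + ∫ s in (0 : ℝ)..y, w s := by
    funext y
    rw [hw.antideriv]
    ring
  rw [h]
  exact continuous_const.add
    (intervalIntegral.continuous_primitive (fun _ _ => hw.integrable.intervalIntegrable) 0)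

theorem hasCompactSupport (hw : IsWeight w W) : HasCompactSupport W :=
  hw.bounded_support_antideriv.isCompact_closure

theorem integrable_antideriv (hw : IsWeight w W) : Integrable W :=
  hw.continuous.integrable_of_hasCompactSupport hw.hasCompactSupport

/-- As `w` is merely integrable, `W` is absolutely continuous with `W' = w` only almost everywhere.
Integration by parts in that form is applied on an interval at whose ends both functions vanish. -/
theorem integral_mul_deriv (hw : IsWeight w W) {φ : ℝ → ℝ} (hφ : ContDiff ℝ 1 φ)
    (hφc : HasCompactSupport φ) : ∫ v, W v * deriv φ v = -∫ v, w v * φ v := by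
  obtain ⟨R, hR⟩ := (hw.hasCompactSupport.isBounded.union hφc.isBounded).subset_ball (0 : ℝ)
  have h0 : ∀ v, v ∉ Ioo (-R) R → W v = 0 ∧ φ v = 0 := by
    intro v hv
    have hv' : v ∉ tsupport W ∪ tsupport φ := fun h => hv (by
      have := hR h
      rwa [Real.ball_eq_Ioo, zero_sub, zero_add] at this)
    rw [mem_union, not_or] at hv'
    exact ⟨image_eq_zero_of_notMem_tsupport hv'.1, image_eq_zero_of_notMem_tsupport hv'.2⟩
  have hWp : W = fun y => ∫ s in (-R)..y, w s := by
    funext y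
    rw [hw.antideriv, (h0 (-R) (by simp)).1, sub_zero]
  have hWac : AbsolutelyContinuousOnInterval W (-R) R := by
    rw [hWp]
    exact hw.integrable.intervalIntegrable.absolutelyContinuousOnInterval_intervalIntegral (by simp)
  have hφac : AbsolutelyContinuousOnInterval φ (-R) R := by
    exact hφ.contDiffOn.absolutelyContinuousOnInterval
  have h1 := hWac.integral_mul_deriv_eq_deriv_mul hφac
  rw [(h0 R (by simp)).1, (h0 (-R) (by simp)).1, zero_mul, zero_mul, sub_zero, zero_sub] at h1
  have hd : ∀ᵐ v, deriv W v = w v := by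
    filter_upwards [LocallyIntegrable.ae_hasDerivAt_integral hw.integrable.locallyIntegrable] with v hv
    rw [hWp]
    exact (hv (-R)).deriv
  rw [intervalIntegral.integral_eq_integral_of_support_subset,
    intervalIntegral.integral_eq_integral_of_support_subset] at h1
  · rw [h1]
    congr 1
    refine integral_congr_ae ?_
    filter_upwards [hd] with v hv
    rw [hv]
  · intro v hv
    by_contra h
    exact hv (by simp [(h0 v fun h' => h (Ioo_subset_Ioc_self h')).2])
  · intro v hv
    by_contra h
    exact hv (by simp [(h0 v fun h' => h (Ioo_subset_Ioc_self h')).1])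

end IsWeight

/-! ### Convolution with derivatives: `W * f' = w * f` -/

section Convolution

variable {a b : ℝ} {w W : ℝ → ℝ}

open scoped Pointwise in
-- The complement is the sum of the compact set `tsupport W` and a closed set, hence closed.
theorem isOpen_windowTimes (hw : IsWeight w W) : IsOpen (windowTimes a b W) := by
  have h : windowTimes a b W = (tsupport W + (Ioo a b)ᶜ)ᶜ := by
    ext t
    simp only [windowTimes, mem_compl_iff, Set.mem_add, not_exists, not_and]
    constructor
    · intro h u hu v hv huv
      exact hv (by have := h u hu; rwa [← huv, add_sub_cancel_left] at this)
    · intro h u hu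
      by_contra h1
      exact h u hu (t - u) h1 (by ring)
  rw [h]
  exact (IsClosed.add_left_of_isCompact isOpen_Ioo.isClosed_compl hw.hasCompactSupport).isOpen_compl

/-- All windows at times in a compact set are in a compact subinterval of `(a, b)`. -/
theorem exists_Icc_window (hw : IsWeight w W) {K : Set ℝ} (hK : IsCompact K)
    (hKW : K ⊆ windowTimes a b W) :
    ∃ c d, a < c ∧ d < b ∧ ∀ t ∈ K, ∀ s, s ∉ Icc c d → W (t - s) = 0 := by
  obtain ⟨c, d, hc, hd, h⟩ := exists_Icc_of_isCompact (K := (fun z : ℝ × ℝ => z.1 - z.2) ''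
    (K ×ˢ tsupport W)) ((hK.prod hw.hasCompactSupport).image (continuous_fst.sub continuous_snd))
    (by
      rintro _ ⟨⟨t, u⟩, ⟨ht, hu⟩, rfl⟩
      exact hKW ht u hu)
  refine ⟨c, d, hc, hd, fun t ht s hs => ?_⟩
  by_contra h1
  exact hs (h ⟨(t, t - s), ⟨ht, subset_tsupport _ h1⟩, by simp⟩)

theorem integrable_convolution_restrict {ν : Measure ℝ} [SFinite ν] {f k : ℝ → ℝ}
    (hf : Integrable f ν) (hk : Integrable k) :
    Integrable (fun t => ∫ s, k (t - s) * f s ∂ν) := by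
  have h := (hf.convolution_integrand (ContinuousLinearMap.mul ℝ ℝ) hk).integral_prod_left
  simpa [mul_comm] using h

theorem integral_mul_convolution {ν : Measure ℝ} [SFinite ν] {f k φ : ℝ → ℝ}
    (hf : Integrable f ν) (hk : Integrable k) (hφ : Continuous φ) (hφc : HasCompactSupport φ) :
    ∫ s, (f s * ∫ t, k (t - s) * φ t) ∂ν = ∫ t, (∫ s, k (t - s) * f s ∂ν) * φ t := by
  obtain ⟨C, hC⟩ := hφ.bounded_above_of_compact_support hφc
  have h := ((hf.convolution_integrand (ContinuousLinearMap.mul ℝ ℝ) hk).mul_bdd (c := C)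
    (hφ.comp continuous_fst).aestronglyMeasurable (Eventually.of_forall fun z => hC _))
  simp only [← integral_const_mul, ← integral_mul_const]
  rw [← integral_integral_swap]
  · refine integral_congr_ae (Eventually.of_forall fun s => ?_)
    refine integral_congr_ae (Eventually.of_forall fun t => ?_)
    simp only
    ring
  · refine h.congr (Eventually.of_forall fun z => ?_)
    simp only [ContinuousLinearMap.mul_apply', Function.uncurry, Function.comp_apply]
    ring

section TestConvolution

variable {φ : ℝ → ℝ}

theorem windowTest_eq_convolution (W φ : ℝ → ℝ) : (fun s => ∫ t, W (t - s) * φ t) =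
    convolution (fun v => W (-v)) φ (ContinuousLinearMap.mul ℝ ℝ) volume := by
  funext s
  rw [convolution_eq_swap]
  simp

theorem IsWeight.locallyIntegrable_comp_neg (hw : IsWeight w W) :
    LocallyIntegrable (fun v => W (-v)) :=
  (hw.continuous.comp continuous_neg).locallyIntegrable

theorem IsWeight.contDiff_windowTest (hw : IsWeight w W) (hφ : ContDiff ℝ ∞ φ)
    (hφc : HasCompactSupport φ) : ContDiff ℝ ∞ fun s => ∫ t, W (t - s) * φ t := by
  rw [windowTest_eq_convolution]
  exact hφc.contDiff_convolution_right _ hw.locallyIntegrable_comp_neg hφ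

/-- In the convolution the derivative first falls on the smooth factor `φ`; `integral_mul_deriv`,
applied to a translate of `φ`, moves it onto `W`. -/
theorem IsWeight.deriv_windowTest (hw : IsWeight w W) (hφ : ContDiff ℝ ∞ φ)
    (hφc : HasCompactSupport φ) (s : ℝ) :
    deriv (fun s => ∫ t, W (t - s) * φ t) s = -∫ t, w (t - s) * φ t := by
  have hφ1 : ContDiff ℝ 1 φ := hφ.of_le (by exact_mod_cast le_top)
  rw [windowTest_eq_convolution, (hφc.hasDerivAt_convolution_right _
    hw.locallyIntegrable_comp_neg hφ1 s).deriv, ← windowTest_eq_convolution]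
  have h1 := hw.integral_mul_deriv (φ := fun v => φ (v + s))
    (hφ1.comp (contDiff_id.add contDiff_const)) (hφc.comp_homeomorph (Homeomorph.addRight s))
  simp only [deriv_comp_add_const] at h1
  rw [← integral_sub_right_eq_self _ s, ← integral_sub_right_eq_self (fun v => w v * _) s] at h1
  simpa using h1

theorem exists_testFunction_windowTest (hw : IsWeight w W) (hφ : ContDiff ℝ ∞ φ)
    (hφc : HasCompactSupport φ) (hφW : tsupport φ ⊆ windowTimes a b W) :
    ∃ ψ : 𝓓(timeDomain a b, ℝ), ∀ s, ψ s = ∫ t, W (t - s) * φ t := by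
  obtain ⟨c, d, hc, hd, h⟩ := exists_Icc_window hw hφc hφW
  have hsupp : tsupport (fun s => ∫ t, W (t - s) * φ t) ⊆ Icc c d := by
    refine closure_minimal (fun s hs => ?_) isClosed_Icc
    by_contra h1
    refine hs (integral_eq_zero_of_ae (Eventually.of_forall fun t => ?_))
    by_cases ht : t ∈ tsupport φ
    · simp [h t ht s h1]
    · simp [image_eq_zero_of_notMem_tsupport ht]
  exact ⟨testFunction _ (hw.contDiff_windowTest hφ hφc)
    (isCompact_Icc.of_isClosed_subset (isClosed_tsupport _) hsupp)
    (hsupp.trans fun s hs => ⟨hc.trans_le hs.1, hs.2.trans_lt hd⟩), fun s => rfl⟩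

theorem integral_mul_deriv_windowTest (hw : IsWeight w W) (hφ : ContDiff ℝ ∞ φ)
    (hφc : HasCompactSupport φ) {ψ : 𝓓(timeDomain a b, ℝ)}
    (hψ : ∀ s, ψ s = ∫ t, W (t - s) * φ t) {f : ℝ → ℝ} (hf : IntegrableOn f (Ioo a b)) :
    -∫ s, f s * deriv ψ s = ∫ t, (∫ s in Ioo a b, w (t - s) * f s) * φ t := by
  obtain ⟨c, d, hc, hd, -, h1⟩ := exists_Icc_testFunction ψ
  have h2 : ∫ s, f s * deriv ψ s = ∫ s in Ioo a b, f s * deriv ψ s :=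
    (setIntegral_eq_integral_of_forall_compl_eq_zero fun s hs => by
      rw [h1 s fun hs' => hs ⟨hc.trans_le hs'.1, hs'.2.trans_lt hd⟩, mul_zero]).symm
  rw [← integral_mul_convolution hf hw.integrable hφ.continuous hφc, h2, ← integral_neg]
  refine integral_congr_ae (Eventually.of_forall fun s => ?_)
  simp only
  rw [show (ψ : ℝ → ℝ) = _ from funext hψ, hw.deriv_windowTest hφ hφc]
  ring

theorem integral_mul_windowTest (hw : IsWeight w W) (hφ : ContDiff ℝ ∞ φ)
    (hφc : HasCompactSupport φ) (hφW : tsupport φ ⊆ windowTimes a b W) {g : ℝ → ℝ}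
    (hg : LocallyIntegrableOn g (Ioo a b)) :
    ∫ s, g s * ∫ t, W (t - s) * φ t = ∫ t, (∫ s in Ioo a b, W (t - s) * g s) * φ t := by
  obtain ⟨c, d, hc, hd, h⟩ := exists_Icc_window hw hφc hφW
  have hsub : Icc c d ⊆ Ioo a b := fun s hs => ⟨hc.trans_le hs.1, hs.2.trans_lt hd⟩
  have hgi := integrableOn_Icc_of_locallyIntegrableOn hg hc hd
  have h1 := integral_mul_convolution hgi hw.integrable_antideriv hφ.continuous hφc
  have h2 : ∀ t, (∫ s in Ioo a b, W (t - s) * g s) * φ t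
      = (∫ s in Icc c d, W (t - s) * g s) * φ t := by
    intro t
    by_cases ht : t ∈ tsupport φ
    · congr 1
      refine (setIntegral_eq_of_subset_of_forall_sdiff_eq_zero measurableSet_Ioo hsub
        fun s hs => ?_)
      rw [h t ht s hs.2, zero_mul]
    · rw [image_eq_zero_of_notMem_tsupport ht, mul_zero, mul_zero]
  simp only [h2]
  rw [← h1]
  refine (setIntegral_eq_integral_of_forall_compl_eq_zero fun s hs => ?_).symm
  rw [integral_eq_zero_of_ae, mul_zero]
  refine Eventually.of_forall fun t => ?_
  by_cases ht : t ∈ tsupport φ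
  · simp [h t ht s hs]
  · simp [image_eq_zero_of_notMem_tsupport ht]

end TestConvolution

/-- `D ψ = -∫ f ψ'`, and `ψ'` is the window integral with `-w` in place of `W`; Fubini puts `w * f`
against `φ`. Thus `w * f` serves as `W * f'`. -/
theorem isConvolution_of_isDistribDeriv (hw : IsWeight w W) {f : ℝ → ℝ}
    (hf : IntegrableOn f (Ioo a b)) {D : 𝓓'(timeDomain a b, ℝ)} (hD : IsDistribDeriv a b f D) :
    IsConvolution a b W D fun t => ∫ s in Ioo a b, w (t - s) * f s := by
  refine ⟨((integrable_convolution_restrict hf hw.integrable).locallyIntegrable.locallyIntegrableOn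
    _), fun φ hφ hφc hφW => ?_⟩
  obtain ⟨ψ, hψ⟩ := exists_testFunction_windowTest hw hφ hφc hφW
  exact ⟨ψ, hψ, by rw [hD.2, integral_mul_deriv_windowTest hw hφ hφc hψ hf]⟩

theorem locallyIntegrableOn_window (hw : IsWeight w W) {g : ℝ → ℝ}
    (hg : LocallyIntegrableOn g (Ioo a b)) :
    LocallyIntegrableOn (fun t => ∫ s in Ioo a b, W (t - s) * g s) (windowTimes a b W) := by
  rw [locallyIntegrableOn_iff (isOpen_windowTimes hw).isLocallyClosed]
  intro K hK hKc
  obtain ⟨c, d, hc, hd, h⟩ := exists_Icc_window hw hKc hK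
  have hgi := integrableOn_Icc_of_locallyIntegrableOn hg hc hd
  refine (integrable_convolution_restrict hgi hw.integrable_antideriv).integrableOn.congr_fun
    (fun t ht => ?_) hKc.measurableSet
  refine (setIntegral_eq_of_subset_of_forall_sdiff_eq_zero measurableSet_Ioo
    (fun s hs => ⟨hc.trans_le hs.1, hs.2.trans_lt hd⟩) fun s hs => ?_).symm
  rw [h t ht s hs.2, zero_mul]

/-- For a weak derivative `g` of `f` one has `W * g = w * f` almost everywhere. -/
theorem IsWeakDeriv.ae_window_eq (hw : IsWeight w W) {f g : ℝ → ℝ}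
    (hf : IntegrableOn f (Ioo a b)) (hg : IsWeakDeriv a b f g) :
    ∀ᵐ t ∂volume.restrict (windowTimes a b W),
      ∫ s in Ioo a b, w (t - s) * f s = ∫ s in Ioo a b, W (t - s) * g s := by
  have hopen := isOpen_windowTimes (a := a) (b := b) hw
  rw [ae_restrict_iff' hopen.measurableSet]
  have h1 := (integrable_convolution_restrict hf hw.integrable).locallyIntegrable.locallyIntegrableOn
    (windowTimes a b W)
  have h2 := locallyIntegrableOn_window hw hg.2.1
  -- Both sides have equal integrals against every test function on the open set of window times, so
  -- they agree almost everywhere.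
  have h := hopen.ae_eq_zero_of_integral_contDiff_smul_eq_zero (h1.sub h2)
    (fun φ hφ hφc hφW => by
      obtain ⟨ψ, hψ⟩ := exists_testFunction_windowTest hw hφ hφc hφW
      have h3 := hg.2.2 ψ
      simp only [hψ] at h3
      rw [integral_mul_deriv_windowTest hw hφ hφc hψ hf,
        integral_mul_windowTest hw hφ hφc hφW hg.2.1] at h3
      have h4 : ∀ F : ℝ → ℝ, LocallyIntegrableOn F (windowTimes a b W) →
          Integrable fun t => F t * φ t := fun F hF => by
        have h5 := (hF.integrableOn_compact_subset hφW hφc)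
        have h6 : IntegrableOn (fun t => F t * φ t) (tsupport φ) := by
          obtain ⟨C, hC⟩ := hφ.continuous.bounded_above_of_compact_support hφc
          exact h5.mul_bdd (c := C) hφ.continuous.aestronglyMeasurable (Eventually.of_forall hC)
        rwa [integrableOn_iff_integrable_of_support_subset] at h6
        exact fun t ht => subset_tsupport _ fun h7 => ht (by simp [h7])
      simp only [smul_eq_mul, Pi.sub_apply, mul_comm (φ _), sub_mul]
      rw [integral_sub (h4 _ h1) (h4 _ h2), h3, sub_self])
  filter_upwards [h] with t ht htW
  exact sub_eq_zero.1 (ht htW)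

/-- A locally integrable classical derivative is a weak derivative. -/
theorem isWeakDeriv_deriv {f : ℝ → ℝ} (hf : DifferentiableOn ℝ f (Ioo a b))
    (hf' : LocallyIntegrableOn (deriv f) (Ioo a b)) : IsWeakDeriv a b f (deriv f) := by
  refine ⟨hf.continuousOn.locallyIntegrableOn measurableSet_Ioo, hf', fun φ => ?_⟩
  obtain ⟨c, d, hc, hd, h1, h2⟩ := exists_Icc_testFunction φ
  rcases lt_or_ge d c with hdc | hcd
  -- The support interval may come with `d < c`, in which case `φ` is zero.
  · have h3 : ∀ t, φ t = 0 ∧ deriv φ t = 0 := fun t =>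
      ⟨h1 t fun h => by linarith [h.1, h.2], h2 t fun h => by linarith [h.1, h.2]⟩
    simp [h3]
  · have hsub : Icc c d ⊆ Ioc ((a + c) / 2) ((d + b) / 2) := fun t ht =>
      ⟨by linarith [ht.1], by linarith [ht.2]⟩
    have hle : (a + c) / 2 ≤ (d + b) / 2 := by linarith
    have h3 := intervalIntegral.integral_mul_deriv_eq_deriv_mul (a := (a + c) / 2)
      (b := (d + b) / 2) (u := f) (v := φ) (u' := deriv f) (v' := deriv φ)
      (fun t ht => by
        rw [uIcc_of_le hle] at ht
        exact (hf.differentiableAt (isOpen_Ioo.mem_nhds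
          ⟨by linarith [ht.1], by linarith [ht.2]⟩)).hasDerivAt)
      (fun t _ => (differentiable_testFunction φ t).hasDerivAt)
      ((intervalIntegrable_iff_integrableOn_Icc_of_le hle).2
        (integrableOn_Icc_of_locallyIntegrableOn hf' (by linarith) (by linarith)))
      (integrable_deriv_testFunction φ).intervalIntegrable
    rw [h1 ((a + c) / 2) fun h => by linarith [h.1], h1 ((d + b) / 2) fun h => by linarith [h.2],
      intervalIntegral.integral_eq_integral_of_support_subset,
      intervalIntegral.integral_eq_integral_of_support_subset] at h3
    · rw [h3]
      ring
    · intro t ht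
      by_contra h
      exact ht (by simp [h1 t fun h' => h (hsub h')])
    · intro t ht
      by_contra h
      exact ht (by simp [h2 t fun h' => h (hsub h')])

end Convolution

/-! ### Convergence of series in `L²` -/

/-- Pointwise convergence of a series of nonnegative functions to a function with integrable
square is convergence in `L²`. -/
theorem hasSumL2_of_hasSum {ι : Type*} [Countable ι] {S : Set ℝ} {F : ι → ℝ → ℝ} {G D : ℝ → ℝ}
    (hF : ∀ i, AEStronglyMeasurable (F i) (volume.restrict S)) (hF0 : ∀ i t, 0 ≤ F i t)
    (hFG : ∀ᵐ t ∂volume.restrict S, HasSum (fun i => F i t) (G t)) (hGD : ∀ t, G t ^ 2 ≤ D t)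
    (hD : IntegrableOn D S) : HasSumL2 S F G := by
  have hsumG : ∀ᵐ t ∂volume.restrict S, ∀ J : Finset ι, ∑ i ∈ J, F i t ≤ G t :=
    hFG.mono fun t ht J => sum_le_hasSum J (fun i _ => hF0 i t) ht
  have hmem : ∀ f : ℝ → ℝ, AEStronglyMeasurable f (volume.restrict S) →
      (∀ᵐ t ∂volume.restrict S, |f t| ≤ G t) → MemLp f 2 (volume.restrict S) := by
    intro f hf hfG
    rw [memLp_two_iff_integrable_sq hf]
    refine Integrable.mono' hD (hf.pow 2) (hfG.mono fun t ht => ?_)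
    rw [Real.norm_of_nonneg (sq_nonneg _)]
    exact (sq_le_sq' (by linarith [neg_abs_le (f t)]) (le_of_abs_le ht)).trans (hGD t)
  have hGm : AEStronglyMeasurable G (volume.restrict S) := by
    refine aestronglyMeasurable_of_tendsto_ae (u := (atTop : Filter (Finset ι)))
      (f := fun J t => ∑ i ∈ J, F i t) (fun J => ?_) hFG
    exact Finset.aestronglyMeasurable_fun_sum J fun i _ => hF i
  refine ⟨fun i => hmem _ (hF i) ?_, hmem _ hGm ?_, ?_⟩
  · filter_upwards [hsumG] with t ht
    rw [abs_of_nonneg (hF0 i t)]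
    simpa using ht {i}
  · filter_upwards [hsumG] with t ht
    rw [abs_of_nonneg (by simpa using ht ∅)]
  · have hm : ∀ J : Finset ι, AEStronglyMeasurable (fun t => ∑ i ∈ J, F i t - G t)
        (volume.restrict S) := fun J =>
      (Finset.aestronglyMeasurable_fun_sum J fun i _ => hF i).sub hGm
    -- Partial sums of nonnegative terms lie between `0` and `G`, so the squared error is at most `G
    -- ^ 2 ≤ D`.
    have key : Tendsto (fun J : Finset ι => ∫ t in S, (∑ i ∈ J, F i t - G t) ^ 2) atTop
        (𝓝 (∫ t in S, (0 : ℝ))) := by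
      refine tendsto_integral_filter_of_dominated_convergence D
        (Eventually.of_forall fun J => (hm J).pow 2) (Eventually.of_forall fun J => ?_) hD ?_
      · filter_upwards [hsumG] with t ht
        rw [Real.norm_of_nonneg (sq_nonneg _)]
        refine le_trans ?_ (hGD t)
        have h1 := ht J
        have h2 : 0 ≤ ∑ i ∈ J, F i t := Finset.sum_nonneg fun i _ => hF0 i t
        nlinarith
      · filter_upwards [hFG] with t ht
        have h3 : Tendsto (fun J : Finset ι => ∑ i ∈ J, F i t) atTop (𝓝 (G t)) := ht
        simpa using (h3.sub_const (G t)).pow 2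
    have hnorm : ∀ J : Finset ι, eLpNorm (fun t => ∑ i ∈ J, F i t - G t) 2 (volume.restrict S)
        = ENNReal.ofReal (∫ t in S, (∑ i ∈ J, F i t - G t) ^ 2) ^ (1 / 2 : ℝ) := by
      intro J
      have h4 : MemLp (fun t => ∑ i ∈ J, F i t - G t) 2 (volume.restrict S) := by
        refine hmem _ (hm J) (hsumG.mono fun t ht => ?_)
        have h2 : 0 ≤ ∑ i ∈ J, F i t := Finset.sum_nonneg fun i _ => hF0 i t
        rw [abs_le]
        constructor <;> linarith [ht J]
      rw [eLpNorm_eq_lintegral_rpow_enorm_toReal (by simp) (by simp),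
        ofReal_integral_eq_lintegral_ofReal h4.integrable_sq
          (Eventually.of_forall fun t => sq_nonneg _)]
      congr 1
      refine lintegral_congr fun t => ?_
      rw [← sq_abs, ENNReal.ofReal_pow (abs_nonneg _), ← Real.norm_eq_abs, ofReal_norm]
      simp
    simp only [hnorm]
    have h5 := (ENNReal.continuous_rpow_const (y := (1 / 2 : ℝ))).tendsto _ |>.comp
      ((ENNReal.continuous_ofReal.tendsto _).comp key)
    simpa [Function.comp_def] using h5

theorem HasSumL2.congr_ae {ι : Type*} {S : Set ℝ} {F F' : ι → ℝ → ℝ} {G : ℝ → ℝ}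
    (h : HasSumL2 S F G) (hF : ∀ i, F i =ᵐ[volume.restrict S] F' i) : HasSumL2 S F' G := by
  refine ⟨fun i => (h.1 i).ae_eq (hF i), h.2.1, h.2.2.congr fun J => eLpNorm_congr_ae ?_⟩
  have h1 : ∀ᵐ t ∂volume.restrict S, ∀ i ∈ J, F i t = F' i t :=
    (eventually_all_finset J).2 fun i _ => hF i
  filter_upwards [h1] with t ht
  rw [Finset.sum_congr rfl ht]

/-! ### The main identity and the regularity of eigenfunctions -/

section Eigensystem

variable {X : Type*} [MeasurableSpace X] {H : Type*} [NormedAddCommGroup H]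
  [InnerProductSpace ℝ H] [CompleteSpace H] [RKHS ℝ H X ℝ]
  {p : Kernel ℝ X} [IsMarkovKernel p] {a b : ℝ}

/-- Pairing the mixture with itself gives `‖v‖² ≤ C ‖g‖₁ ‖v‖`, from which one factor `‖v‖` is
cancelled. -/
theorem IsBoundedKernel.exists_norm_driftMean_le (hK : IsBoundedKernel (X := X) H)
    (p : Kernel ℝ X) [IsMarkovKernel p] (a b : ℝ) : ∃ C, 0 ≤ C ∧ ∀ g : ℝ → ℝ,
      IntegrableOn g (Ioo a b) → ‖driftMean H p a b g‖ ≤ C * ∫ s in Ioo a b, |g s| := by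
  obtain ⟨C, h0, hC⟩ := hK.exists_abs_inner_le p
  refine ⟨C, h0, fun g hg => ?_⟩
  have h1 : ‖driftMean H p a b g‖ * ‖driftMean H p a b g‖
      ≤ (C * ∫ s in Ioo a b, |g s|) * ‖driftMean H p a b g‖ := by
    rw [← real_inner_self_eq_norm_mul_norm, hK.inner_driftMean p hg, ← integral_const_mul,
      ← integral_mul_const]
    refine (le_abs_self _).trans (abs_integral_le_integral_abs.trans ?_)
    refine integral_mono (hK.integrable_mul_inner p hg _).abs
      ((hg.abs.const_mul C).mul_const _) fun s => ?_
    simp only [abs_mul]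
    have := mul_le_mul_of_nonneg_left (hC (driftMean H p a b g) s) (abs_nonneg (g s))
    linarith
  by_contra hcon
  rw [not_le] at hcon
  have h2 : 0 ≤ C * ∫ s in Ioo a b, |g s| :=
    mul_nonneg h0 (integral_nonneg fun s => abs_nonneg _)
  have h3 : 0 < ‖driftMean H p a b g‖ := h2.trans_lt hcon
  exact absurd (le_of_mul_le_mul_right h1 h3) (not_le.2 hcon)

theorem kernelNorm_convDrift (H : Type*) [NormedAddCommGroup H] [InnerProductSpace ℝ H]
    [CompleteSpace H] [RKHS ℝ H X ℝ] (p : Kernel ℝ X) [IsMarkovKernel p] (a b : ℝ) (w : ℝ → ℝ)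
    (t : ℝ) :
    kernelNorm H (convDrift p a b w t) = ‖driftMean H p a b fun s => w (t - s)‖ := rfl

variable {ι : Type} {lam : ι → ℝ} {f : ι → ℝ → ℝ} {w : ℝ → ℝ}

theorem IsEigensystem.hasSum_convDrift (hK : IsBoundedKernel (X := X) H)
    (hs : IsEigensystem (autoCorr H p) a b lam f) (hw : Integrable w) (t : ℝ) :
    HasSum (fun i => lam i * (∫ s in Ioo a b, w (t - s) * f i s) ^ 2)
      (kernelNorm H (convDrift p a b w t) ^ 2) :=
  hs.hasSum_sq_norm_driftMean hK (hw.comp_sub_left t).integrableOn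

theorem IsEigensystem.hasSumL2_convDrift (hK : IsBoundedKernel (X := X) H)
    (hs : IsEigensystem (autoCorr H p) a b lam f) (hw : Integrable w) (S : Set ℝ) :
    HasSumL2 S (fun i t => lam i * (∫ s in Ioo a b, w (t - s) * f i s) ^ 2)
      (fun t => kernelNorm H (convDrift p a b w t) ^ 2) := by
  have := hs.countable
  obtain ⟨C, h0, hC⟩ := hK.exists_norm_driftMean_le p a b
  let N : ℝ → ℝ := fun t => ∫ s in Ioo a b, |w (t - s)|
  have hN0 : ∀ t, 0 ≤ N t := fun t => integral_nonneg fun s => abs_nonneg _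
  have hNi : Integrable N := by
    have h1 := integrable_convolution_restrict (ν := volume.restrict (Ioo a b)) (f := fun _ => 1)
      (integrable_const _) hw.abs
    simpa using h1
  have hN1 : ∀ t, N t ≤ ∫ s, |w s| := by
    intro t
    rw [← integral_sub_left_eq_self (fun s => |w s|) volume t]
    exact setIntegral_le_integral (hw.comp_sub_left t).abs
      (Eventually.of_forall fun s => abs_nonneg _)
  -- The limit squared is a fourth power of the norm, at most `(C * N t) ^ 4`. Three factors `N t`
  -- are bounded by `‖w‖₁`; the last is kept for integrability on a possibly unbounded `S`.
  refine hasSumL2_of_hasSum (D := fun t => (C ^ 4 * (∫ s, |w s|) ^ 3) * N t) (fun i => ?_)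
    (fun i t => mul_nonneg (hs.eigenvalue_pos hK i).le (sq_nonneg _))
    (Eventually.of_forall fun t => hs.hasSum_convDrift hK hw t) (fun t => ?_)
    (hNi.const_mul _).integrableOn
  · exact (((integrable_convolution_restrict (hs.eigenfunction i).integrableOn hw).1.pow
      2).const_mul _).restrict
  · rw [kernelNorm_convDrift]
    have h1 := hC _ (hw.comp_sub_left t).integrableOn
    calc (‖driftMean H p a b fun s => w (t - s)‖ ^ 2) ^ 2 ≤ ((C * N t) ^ 2) ^ 2 := by gcongr
      _ = C ^ 4 * N t ^ 3 * N t := by ring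
      _ ≤ C ^ 4 * (∫ s, |w s|) ^ 3 * N t := by
        gcongr
        exact hN1 t

theorem IsEigensystem.hasSumL2_weak (hK : IsBoundedKernel (X := X) H)
    (hs : IsEigensystem (autoCorr H p) a b lam f) {W : ℝ → ℝ} (hw : IsWeight w W)
    {g : ι → ℝ → ℝ} (hg : ∀ i, IsWeakDeriv a b (f i) (g i)) :
    HasSumL2 (windowTimes a b W) (fun i t => lam i * (∫ s in Ioo a b, W (t - s) * g i s) ^ 2)
      (fun t => kernelNorm H (convDrift p a b w t) ^ 2) := by
  refine (hs.hasSumL2_convDrift hK hw.integrable _).congr_ae fun i => ?_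
  filter_upwards [(hg i).ae_window_eq hw (hs.eigenfunction i).integrableOn] with t ht
  rw [ht]

/-- The integrand is one fixed bounded function on `X`, so `f` inherits the regularity in `t` of
integrals against `p t`. -/
theorem IsEigenfunction.eq_integral (hK : IsBoundedKernel (X := X) H) {μ : ℝ} {f : ℝ → ℝ}
    (hf : IsEigenfunction (autoCorr H p) a b μ f) (hμ : μ ≠ 0) {t : ℝ} (ht : t ∈ Ioo a b) :
    f t = μ⁻¹ * ∫ x, (driftMean H p a b f : H) x ∂(p t) := by
  rw [← hK.inner_kernelMean_measure, hf.inner_kernelMean hK ht, inv_mul_cancel_left₀ hμ]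

theorem IsEigenfunction.locallyIntegrableOn {K : ℝ → ℝ → ℝ} {μ : ℝ} {f : ℝ → ℝ}
    (hf : IsEigenfunction K a b μ f) : LocallyIntegrableOn f (Ioo a b) :=
  hf.integrableOn.locallyIntegrableOn

theorem IsEigenfunction.differentiableOn (hK : IsBoundedKernel (X := X) H) {μ : ℝ} {f : ℝ → ℝ}
    (hf : IsEigenfunction (autoCorr H p) a b μ f) (hμ : μ ≠ 0)
    (hp : ClassicallyDifferentiable p a b) : DifferentiableOn ℝ f (Ioo a b) := by
  obtain ⟨C, -, hC⟩ := hK.exists_abs_apply_le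
  exact ((hp.differentiableOn_integral (hK.measurable_apply _) (hC _)).const_mul μ⁻¹).congr
    fun t ht => hf.eq_integral hK hμ ht

theorem IsEigenfunction.exists_isWeakDeriv (hK : IsBoundedKernel (X := X) H) {μ : ℝ} {f : ℝ → ℝ}
    (hf : IsEigenfunction (autoCorr H p) a b μ f) (hμ : μ ≠ 0)
    (hp : WeaklyDifferentiable p a b) : ∃ g, IsWeakDeriv a b f g := by
  obtain ⟨C, -, hC⟩ := hK.exists_abs_apply_le
  obtain ⟨g, -, hg, hgφ⟩ := hp.exists_isWeakDeriv_integral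
    (hK.measurable_apply (driftMean H p a b f)) (hC _)
  refine ⟨fun t => μ⁻¹ * g t, hf.locallyIntegrableOn,
    locallyIntegrableOn_of_Icc fun c d hc hd =>
      (integrableOn_Icc_of_locallyIntegrableOn hg hc hd).const_mul _, fun φ => ?_⟩
  obtain ⟨c, d, hc, hd, -, h1⟩ := exists_Icc_testFunction φ
  simp only [mul_assoc, integral_const_mul, hgφ φ]
  rw [← neg_eq_iff_eq_neg, mul_neg, neg_neg, ← integral_const_mul]
  refine integral_congr_ae (Eventually.of_forall fun t => ?_)
  by_cases ht : t ∈ Icc c d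
  · simp only
    rw [hf.eq_integral hK hμ ⟨hc.trans_le ht.1, ht.2.trans_lt hd⟩, mul_assoc]
  · simp [h1 t ht]

end Eigensystem

/-! ### Abrupt drift -/

section Abrupt

variable {X : Type*} [MeasurableSpace X] {H : Type*} [NormedAddCommGroup H]
  [InnerProductSpace ℝ H] [CompleteSpace H] [RKHS ℝ H X ℝ]
  {p : Kernel ℝ X} [IsMarkovKernel p] {a b : ℝ} {n : ℕ} {τ : Fin n → ℝ}
  {P : Fin (n + 1) → ProbabilityMeasure X}

theorem exists_segment (hτ : StrictMono τ) (t : ℝ) :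
    ∃ j : Fin (n + 1), ∀ i : Fin n, τ i ≤ t ↔ i.castSucc < j := by
  by_cases h : ∀ i, τ i ≤ t
  · exact ⟨Fin.last n, fun i => ⟨fun _ => i.castSucc_lt_last, fun _ => h i⟩⟩
  · push Not at h
    obtain ⟨k, hk, hmin⟩ := WellFounded.has_min (wellFounded_lt (α := Fin n)) {i | t < τ i} h
    refine ⟨k.castSucc, fun i => ⟨fun hi => ?_, fun hi => ?_⟩⟩
    · rw [Fin.castSucc_lt_castSucc_iff]
      by_contra hki
      exact absurd ((hτ.monotone (not_lt.1 hki)).trans hi) (not_le.2 hk)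
    · rw [Fin.castSucc_lt_castSucc_iff] at hi
      by_contra hti
      exact hmin i (not_le.1 hti) hi

theorem sum_ite_castSucc_lt {E : Type*} [AddCommGroup E] (M : Fin (n + 1) → E) (j : Fin (n + 1)) :
    ∑ i : Fin n, (if i.castSucc < j then M i.succ - M i.castSucc else 0) = M j - M 0 := by
  induction j using Fin.induction with
  | zero => simp
  | succ k ih =>
    have h : ∀ i : Fin n, (if i.castSucc < k.succ then M i.succ - M i.castSucc else 0)
        = (if i.castSucc < k.castSucc then M i.succ - M i.castSucc else 0)
          + if i = k then M i.succ - M i.castSucc else 0 := by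
      intro i
      rcases lt_trichotomy i k with h | h | h
      · simp [Fin.castSucc_lt_succ_iff, h, h.le, h.ne]
      · simp [Fin.castSucc_lt_succ_iff, h]
      · simp [Fin.castSucc_lt_succ_iff, h.ne', not_le.2 h, not_lt.2 h.le]
    simp only [h, Finset.sum_add_distrib, ih, Finset.sum_ite_eq', Finset.mem_univ, if_true]
    abel

variable (H) in
/-- The difference of the kernel embeddings of the concepts at a change point. -/
def meanJump (P : Fin (n + 1) → ProbabilityMeasure X) (j : Fin n) : H :=
  kernelMean H (P j.succ : Measure X).toSignedMeasure
    - kernelMean H (P j.castSucc : Measure X).toSignedMeasure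

theorem jump_eq_norm (hK : IsBoundedKernel (X := X) H) (P : Fin (n + 1) → ProbabilityMeasure X)
    (j : Fin n) : jump H P j = ‖meanJump H P j‖ := by
  rw [jump, kernelNorm, hK.kernelMean_sub]
  rfl

namespace IsAbrupt

/-- At time `t` the embedding is that of `P 0` plus the jumps passed so far, by telescoping. The
exceptional null set is the one in `hp.eq`, common to all `h`. -/
theorem ae_inner_kernelMean (hK : IsBoundedKernel (X := X) H) (hp : IsAbrupt p a b τ P) :
    ∀ᵐ t ∂volume.restrict (Ioo a b), ∀ h : H, inner ℝ (kernelMean H (p t).toSignedMeasure) h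
      = inner ℝ (kernelMean H (P 0 : Measure X).toSignedMeasure) h
        + ∑ j, if τ j ≤ t then inner ℝ (meanJump H P j) h else 0 := by
  filter_upwards [hp.eq] with t ht h
  obtain ⟨j, hj⟩ := exists_segment hp.strictMono t
  rw [hK.inner_kernelMean_measure, ht j hj, ← hK.inner_kernelMean_measure]
  simp only [hj]
  have h1 := sum_ite_castSucc_lt
    (fun j => inner ℝ (kernelMean H (P j : Measure X).toSignedMeasure) h) j
  simp only [meanJump, inner_sub_left, h1]
  ring

theorem driftMean_eq (hK : IsBoundedKernel (X := X) H) (hp : IsAbrupt p a b τ P) {g : ℝ → ℝ}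
    (hg : IntegrableOn g (Ioo a b)) : driftMean H p a b g
      = (∫ s in Ioo a b, g s) • kernelMean H (P 0 : Measure X).toSignedMeasure
        + ∑ j, (∫ s in Ioo a b, if τ j ≤ s then g s else 0) • meanJump H P j := by
  refine ext_inner_right ℝ fun h => ?_
  have hi : ∀ j, IntegrableOn (fun s => if τ j ≤ s then g s else 0) (Ioo a b) := fun j =>
    Integrable.indicator (s := Ici (τ j)) hg measurableSet_Ici
  rw [hK.inner_driftMean p hg, inner_add_left, sum_inner, inner_smul_left]
  simp only [inner_smul_left, RCLike.conj_to_real]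
  simp only [← integral_mul_const]
  rw [← integral_finsetSum _ fun j _ => (hi j).mul_const _,
    ← integral_add (hg.mul_const _) (integrable_finsetSum _ fun j _ => (hi j).mul_const _)]
  refine integral_congr_ae ?_
  filter_upwards [hp.ae_inner_kernelMean hK] with t ht
  rw [ht h, mul_add, Finset.mul_sum]
  congr 1
  refine Finset.sum_congr rfl fun j _ => ?_
  split_ifs <;> simp

variable {w W : ℝ → ℝ}

/-- The jump at `τ j` gets the coefficient `∫ w(t - s) ds` over `(τ j, b)`, which is `W(t - τ j) -
W(t - b)`. For a window time `W(t - s)` vanishes outside `(a, b)`, so the term at `b` and the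
contribution of `P 0` are zero. -/
theorem driftMean_weight (hK : IsBoundedKernel (X := X) H) (hp : IsAbrupt p a b τ P)
    (hab : a < b) (hw : IsWeight w W) {t : ℝ} (ht : t ∈ windowTimes a b W) :
    driftMean H p a b (fun s => w (t - s)) = ∑ j, W (t - τ j) • meanJump H P j := by
  have hout : ∀ s, s ∉ Ioo a b → W (t - s) = 0 := by
    intro s hs
    by_contra h
    refine hs ?_
    have := ht (t - s) (subset_tsupport _ h)
    rwa [sub_sub_cancel] at this
  have hint : ∀ c, c ≤ b → ∫ s in Ioo c b, w (t - s) = W (t - c) := by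
    intro c hc
    rw [← integral_Ioc_eq_integral_Ioo, ← intervalIntegral.integral_of_le hc,
      intervalIntegral.integral_comp_sub_left, hw.antideriv, hout b (by simp), sub_zero]
  rw [hp.driftMean_eq hK (hw.integrable.comp_sub_left t).integrableOn, hint a hab.le,
    hout a (by simp), zero_smul, zero_add]
  refine Finset.sum_congr rfl fun j _ => ?_
  have hτ := hp.mem j
  have h1 : ∫ s in Ioo a b, (if τ j ≤ s then w (t - s) else 0)
      = ∫ s in Ioo a b, (Ici (τ j)).indicator (fun s => w (t - s)) s := rfl
  have h2 : Ioo a b ∩ Ici (τ j) = Ico (τ j) b := by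
    ext s
    simp only [mem_inter_iff, mem_Ioo, mem_Ici, mem_Ico]
    exact ⟨fun h => ⟨h.2, h.1.2⟩, fun h => ⟨⟨hτ.1.trans_le h.1, h.2⟩, h.1⟩⟩
  rw [h1, setIntegral_indicator measurableSet_Ici, h2, integral_Ico_eq_integral_Ioo,
    hint _ hτ.2.le]

/-- Each jump is a weighted mixture of the process. -/
theorem exists_driftMean_eq_meanJump (hK : IsBoundedKernel (X := X) H)
    (hp : IsAbrupt p a b τ P) (hab : a < b) (j : Fin n) :
    ∃ g, IntegrableOn g (Ioo a b) ∧ driftMean H p a b g = meanJump H P j := by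
  -- A bump of radius `ε`, taken as the antiderivative, equals one at `0` and vanishes at `τ j - τ
  -- i` for `i ≠ j`. With `w` its derivative and `t = τ j`, the formula `driftMean_weight` isolates
  -- the jump `j`.
  have hε : ∀ᶠ ε : ℝ in 𝓝[>] 0, 0 < ε ∧ (∀ i, i ≠ j → ε < |τ j - τ i|) ∧
      ε < τ j - a ∧ ε < b - τ j := by
    have hlt : ∀ r : ℝ, 0 < r → ∀ᶠ ε : ℝ in 𝓝[>] 0, ε < r := fun r hr =>
      nhdsWithin_le_nhds (eventually_lt_nhds hr)
    refine eventually_mem_nhdsWithin.and ((eventually_all.2 fun i => ?_).and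
      ((hlt _ (sub_pos.2 (hp.mem j).1)).and (hlt _ (sub_pos.2 (hp.mem j).2))))
    by_cases hij : i = j
    · simp [hij]
    · exact (hlt _ (abs_pos.2 (sub_ne_zero.2 fun h =>
        hij (hp.strictMono.injective h).symm))).mono fun ε h _ => h
  obtain ⟨ε, h0, hτ, ha, hb⟩ := hε.exists
  let B : ContDiffBump (0 : ℝ) := ⟨ε / 2, ε, by linarith, by linarith⟩
  have hBc : ContDiff ℝ 1 B := B.contDiff
  have hw : IsWeight (deriv B) B :=
    { integrable := (hBc.continuous_deriv le_rfl).integrable_of_hasCompactSupport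
        B.hasCompactSupport.deriv
      bounded_support := B.hasCompactSupport.deriv.isBounded.subset (subset_tsupport _)
      bounded_support_antideriv := B.hasCompactSupport.isBounded.subset (subset_tsupport _)
      antideriv := fun x y => intervalIntegral.integral_deriv_eq_sub
        (fun s _ => (hBc.differentiable one_ne_zero) s)
        ((hBc.continuous_deriv le_rfl).intervalIntegrable _ _) }
  have ht : τ j ∈ windowTimes a b B := by
    intro u hu
    rw [B.tsupport_eq, mem_closedBall_zero_iff, Real.norm_eq_abs, abs_le] at hu
    have h1 : -ε ≤ u ∧ u ≤ ε := hu
    constructor <;> linarith [h1.1, h1.2]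
  refine ⟨fun s => deriv B (τ j - s), (hw.integrable.comp_sub_left _).integrableOn, ?_⟩
  rw [hp.driftMean_weight hK hab hw ht, Finset.sum_eq_single j]
  · rw [sub_self, B.one_of_mem_closedBall (by simp [B.rIn_pos.le]), one_smul]
  · intro i _ hij
    rw [B.zero_of_le_dist, zero_smul]
    rw [dist_zero_right, Real.norm_eq_abs]
    exact (hτ i hij).le
  · simp

variable {ι : Type} {lam : ι → ℝ} {f : ι → ℝ → ℝ}

theorem hasSum_inner_meanJump (hK : IsBoundedKernel (X := X) H) (hp : IsAbrupt p a b τ P)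
    (hab : a < b) (hs : IsEigensystem (autoCorr H p) a b lam f) (j : Fin n) :
    HasSum (fun i => inner ℝ (meanJump H P j) (IsEigensystem.basisVector H p a b lam f i) ^ 2)
      (jump H P j ^ 2) := by
  rw [jump_eq_norm hK]
  obtain ⟨g, hg, h⟩ := hp.exists_driftMean_eq_meanJump hK hab j
  exact hs.hasSum_inner_basisVector hK (Submodule.subset_span ⟨g, hg, h⟩)

/-- `√(lam i) * f i t` is the coordinate of the embedding of `p t` along the basis vector, almost
everywhere a step function. Its constant part is killed by `φ'`, and each step contributes `∫ φ'`
over `[τ j, ∞)`, which is `-φ (τ j)`. -/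
theorem integral_mul_deriv (hK : IsBoundedKernel (X := X) H) (hp : IsAbrupt p a b τ P)
    (hs : IsEigensystem (autoCorr H p) a b lam f) (i : ι) (φ : 𝓓(timeDomain a b, ℝ)) :
    -(√(lam i) * ∫ t, f i t * deriv φ t) = ∑ j,
      inner ℝ (meanJump H P j) (IsEigensystem.basisVector H p a b lam f i) * φ (τ j) := by
  set e := IsEigensystem.basisVector H p a b lam f i with he
  obtain ⟨c, d, hc, hd, -, h1⟩ := exists_Icc_testFunction φ
  have hpos := hs.eigenvalue_pos hK i
  have hφi := integrable_deriv_testFunction φ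
  have hf : ∀ᵐ t, √(lam i) * (f i t * deriv φ t)
      = inner ℝ (kernelMean H (P 0 : Measure X).toSignedMeasure) e * deriv φ t
        + ∑ j, inner ℝ (meanJump H P j) e * (Ici (τ j)).indicator (deriv φ) t := by
    filter_upwards [(ae_restrict_iff' measurableSet_Ioo).1 (hp.ae_inner_kernelMean hK)] with t ht
    by_cases htc : t ∈ Icc c d
    · have htI : t ∈ Ioo a b := ⟨hc.trans_le htc.1, htc.2.trans_lt hd⟩
      have h2 : √(lam i) * f i t = inner ℝ (kernelMean H (p t).toSignedMeasure) e := by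
        rw [he, IsEigensystem.basisVector, inner_smul_right,
          (hs.eigenfunction i).inner_kernelMean hK htI, ← mul_assoc]
        congr 1
        rw [inv_mul_eq_div, Real.div_sqrt]
      rw [← mul_assoc, h2, ht htI e, add_mul, Finset.sum_mul]
      congr 1
      refine Finset.sum_congr rfl fun j _ => ?_
      by_cases hj : τ j ≤ t
      · simp [hj]
      · simp [hj]
    · have h3 : ∀ j, (Ici (τ j)).indicator (deriv φ) t = 0 := fun j => by
        rw [indicator_apply, h1 t htc, ite_self]
      simp [h1 t htc, h3]
  rw [← integral_const_mul, integral_congr_ae hf, integral_add (hφi.const_mul _)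
    (integrable_finsetSum _ fun j _ => (hφi.indicator measurableSet_Ici).const_mul _),
    integral_finsetSum _ fun j _ => (hφi.indicator measurableSet_Ici).const_mul _,
    integral_const_mul, integral_deriv_testFunction, mul_zero, zero_add, ← Finset.sum_neg_distrib]
  refine Finset.sum_congr rfl fun j _ => ?_
  rw [integral_const_mul, integral_indicator measurableSet_Ici, integral_Ici_eq_integral_Ioi,
    φ.hasCompactSupport.integral_Ioi_deriv_eq (φ.contDiff.of_le (by simp))]
  ring

/-- Both sides are the square of the same coordinate of the mixture, read off once from the
eigenfunction and once from the jumps. -/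
theorem sqrt_mul_integral_weight (hK : IsBoundedKernel (X := X) H) (hp : IsAbrupt p a b τ P)
    (hab : a < b) (hs : IsEigensystem (autoCorr H p) a b lam f) (hw : IsWeight w W) {t : ℝ}
    (ht : t ∈ windowTimes a b W) (i : ι) : lam i * (∫ s in Ioo a b, w (t - s) * f i s) ^ 2
      = (∑ j, inner ℝ (meanJump H P j) (IsEigensystem.basisVector H p a b lam f i)
          * W (t - τ j)) ^ 2 := by
  have h1 := hs.inner_basisVector hK (hw.integrable.comp_sub_left t).integrableOn i
  rw [hp.driftMean_weight hK hab hw ht, sum_inner] at h1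
  have h2 : ∑ j, inner ℝ (meanJump H P j) (IsEigensystem.basisVector H p a b lam f i)
      * W (t - τ j) = √(lam i) * ∫ s in Ioo a b, w (t - s) * f i s := by
    rw [← h1]
    refine Finset.sum_congr rfl fun j _ => ?_
    rw [inner_smul_left, mul_comm]
    rfl
  rw [h2, mul_pow, Real.sq_sqrt (hs.eigenvalue_pos hK i).le]

/-- If `W` were nonzero at `t - τ j` and `t - τ k`, both would lie in an interval of length `l`,
less than the gap. At most one term survives, so no inner products between jumps occur. -/
theorem sum_jump_mul_abs (hK : IsBoundedKernel (X := X) H) (hp : IsAbrupt p a b τ P)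
    (hab : a < b) (hw : IsWeight w W) {c l : ℝ} (hc : Function.support W ⊆ Icc c (c + l))
    (hl : ∀ i j : Fin n, i < j → l < τ j - τ i) {t : ℝ} (ht : t ∈ windowTimes a b W) :
    ∑ j, jump H P j * |W (t - τ j)| = kernelNorm H (convDrift p a b w t) := by
  rw [kernelNorm_convDrift, hp.driftMean_weight hK hab hw ht]
  simp only [jump_eq_norm hK]
  by_cases h : ∃ k, W (t - τ k) ≠ 0
  · obtain ⟨k, hk⟩ := h
    have h0 : ∀ j, j ≠ k → W (t - τ j) = 0 := by
      intro j hjk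
      by_contra hj
      have h1 := hc hk
      have h2 := hc hj
      rcases lt_or_gt_of_ne hjk with h3 | h3
      · linarith [hl j k h3, h1.1, h1.2, h2.1, h2.2]
      · linarith [hl k j h3, h1.1, h1.2, h2.1, h2.2]
    rw [Finset.sum_eq_single k (fun j _ hj => by simp [h0 j hj]) (by simp),
      Finset.sum_eq_single k (fun j _ hj => by simp [h0 j hj]) (by simp), norm_smul, mul_comm,
      Real.norm_eq_abs]
  · push Not at h
    simp [h]

end IsAbrupt

end Abrupt

end

end Drift

/-! ### The theorem -/

theorem theorem1 {X : Type*} [TopologicalSpace X] [CompactSpace X] [MeasurableSpace X]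
    [BorelSpace X]
    {H : Type*} [NormedAddCommGroup H] [InnerProductSpace ℝ H] [CompleteSpace H] [RKHS ℝ H X ℝ]
    (hk : Measurable (Function.uncurry (scalarKernel (X := X) H)))
    (hbdd : ∃ C : ℝ, ∀ x : X, scalarKernel H x x < C)
    (a b : ℝ) (hab : a < b) (p : Kernel ℝ X) [IsMarkovKernel p] :
    -- eigenfunctions are differentiable in the same sense as the process
    (∀ (lam : ℝ) (f : ℝ → ℝ), lam ≠ 0 →
      IsEigenfunction (autoCorr H p) a b lam f →
        (ClassicallyDifferentiable p a b → DifferentiableOn ℝ f (Ioo a b)) ∧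
        (WeaklyDifferentiable p a b →
          ∃ g : ℝ → ℝ, IsWeakDeriv a b f g) ∧
        (DistribDifferentiable p a b →
          ∃ D : 𝓓'(timeDomain a b, ℝ), IsDistribDeriv a b f D)) ∧
    -- a complete system of eigenfunctions exists
    (∃ (ι : Type) (_ : Countable ι) (lam : ι → ℝ) (f : ι → ℝ → ℝ),
      IsEigensystem (autoCorr H p) a b lam f) ∧
    -- the statements about an arbitrary complete system
    (∀ (ι : Type) (lam : ι → ℝ) (f : ι → ℝ → ℝ),
      IsEigensystem (autoCorr H p) a b lam f →
        (∀ i, 0 < lam i) ∧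
        (∀ w W : ℝ → ℝ, IsWeight w W →
          -- distributional derivatives
          (∀ D : ι → 𝓓'(timeDomain a b, ℝ),
            (∀ i, IsDistribDeriv a b (f i) (D i)) →
              ∃ u : ι → ℝ → ℝ, (∀ i, IsConvolution a b W (D i) (u i)) ∧
                HasSumL2 (windowTimes a b W)
                  (fun i t => lam i * u i t ^ 2)
                  (fun t => kernelNorm H
                    (convDrift p a b w t) ^ 2)) ∧
          -- weak derivatives
          (∀ g : ι → ℝ → ℝ, (∀ i, IsWeakDeriv a b (f i) (g i)) →
            HasSumL2 (windowTimes a b W)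
              (fun i t => lam i * (∫ s in Ioo a b, W (t - s) * g i s) ^ 2)
              (fun t => kernelNorm H (convDrift p a b w t) ^ 2)) ∧
          -- classical derivatives
          ((∀ i, DifferentiableOn ℝ (f i) (Ioo a b) ∧
              LocallyIntegrableOn (deriv (f i)) (Ioo a b)) →
            HasSumL2 (windowTimes a b W)
              (fun i t => lam i * (∫ s in Ioo a b, W (t - s) * deriv (f i) s) ^ 2)
              (fun t => kernelNorm H (convDrift p a b w t) ^ 2))) ∧
        -- abrupt drift only
        (∀ (n : ℕ) (τ : Fin n → ℝ) (P : Fin (n + 1) → ProbabilityMeasure X),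
          IsAbrupt p a b τ P →
            ∃ s : ι → Fin n → ℝ,
              (∀ i, ∀ φ : 𝓓(timeDomain a b, ℝ),
                -(√(lam i) * ∫ t, f i t * deriv φ t) = ∑ j, s i j * φ (τ j)) ∧
              (∀ j, HasSum (fun i => s i j ^ 2) (jump H P j ^ 2)) ∧
              ∀ w W : ℝ → ℝ, IsWeight w W →
                HasSumL2 (windowTimes a b W)
                  (fun i t => (∑ j, s i j * W (t - τ j)) ^ 2)
                  (fun t => kernelNorm H
                    (convDrift p a b w t) ^ 2) ∧
                ∀ t ∈ windowTimes a b W,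
                  HasSum (fun i => (∑ j, s i j * W (t - τ j)) ^ 2)
                    (kernelNorm H (convDrift p a b w t) ^ 2))) ∧
    -- abrupt drift only, window shorter than all gaps between change points
    (∀ (n : ℕ) (τ : Fin n → ℝ) (P : Fin (n + 1) → ProbabilityMeasure X),
      IsAbrupt p a b τ P →
        ∀ w W : ℝ → ℝ, IsWeight w W →
          ∀ c l : ℝ, Function.support W ⊆ Icc c (c + l) →
            (∀ i j : Fin n, i < j → l < τ j - τ i) →
              ∀ t ∈ windowTimes a b W,
                ∑ j, jump H P j * |W (t - τ j)|
                    = kernelNorm H (convDrift p a b w t) ∧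
                ((∀ x, 0 ≤ W x) →
                  ∑ j, jump H P j * W (t - τ j)
                    = kernelNorm H (convDrift p a b w t))) := by
  have hK : IsBoundedKernel (X := X) H := ⟨hk, hbdd⟩
  refine ⟨fun lam f hlam hf => ⟨fun hp => hf.differentiableOn hK hlam hp,
      fun hp => hf.exists_isWeakDeriv hK hlam hp,
      fun _ => exists_isDistribDeriv hf.locallyIntegrableOn⟩,
    exists_isEigensystem hK p a b, fun ι lam f hs => ⟨hs.eigenvalue_pos hK,
      fun w W hw => ⟨fun D hD => ?_, fun g hg => hs.hasSumL2_weak hK hw hg,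
        fun hf => hs.hasSumL2_weak hK hw fun i => isWeakDeriv_deriv (hf i).1 (hf i).2⟩,
      fun n τ P hp => ?_⟩, fun n τ P hp w W hw c l hc hl t ht => ?_⟩
  · exact ⟨fun i t => ∫ s in Ioo a b, w (t - s) * f i s,
      fun i => isConvolution_of_isDistribDeriv hw (hs.eigenfunction i).integrableOn (hD i),
      hs.hasSumL2_convDrift hK hw.integrable _⟩
  · have hsum : ∀ w W : ℝ → ℝ, IsWeight w W → ∀ i, ∀ t ∈ windowTimes a b W,
        lam i * (∫ s in Ioo a b, w (t - s) * f i s) ^ 2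
          = (∑ j, inner ℝ (meanJump H P j) (IsEigensystem.basisVector H p a b lam f i)
              * W (t - τ j)) ^ 2 := by
      intro w W hw i t ht
      rw [← hp.sqrt_mul_integral_weight hK hab hs hw ht i]
    -- The coordinates of the jumps in the orthonormal system, fixed before any weight is chosen.
    refine ⟨fun i j => inner ℝ (meanJump H P j) (IsEigensystem.basisVector H p a b lam f i),
      hp.integral_mul_deriv hK hs, hp.hasSum_inner_meanJump hK hab hs, fun w W hw => ⟨?_, ?_⟩⟩
    · exact (hs.hasSumL2_convDrift hK hw.integrable _).congr_ae fun i =>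
        ae_restrict_of_forall_mem (isOpen_windowTimes hw).measurableSet (hsum w W hw i)
    · intro t ht
      simpa only [hsum w W hw _ t ht] using hs.hasSum_convDrift hK hw.integrable t
  · have h := hp.sum_jump_mul_abs hK hab hw hc hl ht
    exact ⟨h, fun hW => by simpa only [abs_of_nonneg (hW _)] using h⟩
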